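/- Let $d\ge 1$ be an integer. An open set $O\subset\mathbb R^{n}$ is called an observability open set on the whole space $\mathbb R^n$ if there exist $\delta>0$ and $r>0$ such that for every $y\in\mathbb R^n$ there is $y'\in O$ with $B(y',r)\subset O$ and $|y-y'|\le\delta$, where $B(y',r)$ is the open Euclidean ball of radius $r$ centred at $y'$. For $g_0\in L^2(\mathbb R^{2d})$ consider the Kolmogorov equation $$(\partial_t+v\cdot\nabla_x-\Delta_v)g(t,x,v)=0,\quad (t,x,v)\in(0,\infty)\times\mathbb R^d\times\mathbb R^d,\qquad g(0,x,v)=g_0(x,v).$$ A solution is a function $g\in C([0,\infty);L^2(\mathbb R^{2d}))$ with $g(0)=g_0$ that satisfies the equation in the weak sense: for all $\varphi\in C_c^\infty(\mathbb R^{2d})$ and $t\ge 0$, $$\int g(t)\varphi\,\mathrm dx\,\mathrm dv=\int g_0\varphi\,\mathrm dx\,\mathrm dv+\int_0^t\!\int g(s)\,(v\cdot\nabla_x\varphi+\Delta_v\varphi)\,\mathrm dx\,\mathrm dv\,\mathrm ds.$$ Let $\omega\subset\mathbb R^{2d}$ be an observability open set on the whole space $\mathbb R^{2d}$. (i) Let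 $T>0$ and let $E\subset(0,T)$ be a Lebesgue measurable set of positive measure. Then there exists a constant $C_{obs}=C_{obs}(\omega,d,T,E)>0$ such that for each $g_0\in L^2(\mathbb R^{2d})$ the solution $g$ of the Kolmogorov equation with initial datum $g_0$ satisfies $$\|g(T)\|_{L^2(\mathbb R^{2d})}\le C_{obs}\int_E\|g(t,\cdot,\cdot)\|_{L^2(\omega)}\,\mathrm dt .$$ (ii) When $E=(0,T)$ one can take $C_{obs}=e^{C(1+1/T^3)}$ in (i), with a constant $C>0$ that depends only on $\omega$ and $d$ (and not on $T$ or $g_0$). -/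

import Mathlib

open MeasureTheory

noncomputable section

/-- The phase space `ℝ^{2d} = ℝ^d_x × ℝ^d_v`, with its Euclidean norm and Lebesgue measure.
For `z = (x, v)`, the coordinate `x_i` is `z (Sum.inl i)` and `v_i` is `z (Sum.inr i)`. -/
abbrev PhaseSpace (d : ℕ) : Type := EuclideanSpace ℝ (Fin d ⊕ Fin d)

/-- The space `L²(ℝ^{2d})` of complex-valued square-integrable functions. -/
abbrev PhaseL2 (d : ℕ) : Type := Lp ℂ 2 (volume : Measure (PhaseSpace d))

/-- `O ⊆ ℝ^n` is an observability open set on the whole space: `O` is open, and there are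
`δ, r > 0` such that every point of `ℝ^n` lies within distance `δ` of the centre of an open ball
of radius `r` that is contained in `O`. -/
def IsObservabilityOpenSet {ι : Type*} [Fintype ι] (O : Set (EuclideanSpace ℝ ι)) : Prop :=
  IsOpen O ∧ ∃ δ > 0, ∃ r > 0, ∀ y : EuclideanSpace ℝ ι,
    ∃ y' ∈ O, Metric.ball y' r ⊆ O ∧ dist y y' ≤ δ

/-- The `i`-th partial derivative `∂_i φ`. -/
def partialDeriv {ι : Type*} [Fintype ι] [DecidableEq ι] (i : ι)
    (φ : EuclideanSpace ℝ ι → ℂ) : EuclideanSpace ℝ ι → ℂ :=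
  fun z => fderiv ℝ φ z (EuclideanSpace.single i 1)

/-- The formal adjoint `v · ∇_x + Δ_v` of the operator `-v · ∇_x + Δ_v`. -/
def kolmogorovAdjoint {d : ℕ} (φ : PhaseSpace d → ℂ) : PhaseSpace d → ℂ :=
  fun z => ∑ i : Fin d, (z (Sum.inr i) : ℂ) * partialDeriv (Sum.inl i) φ z
    + ∑ i : Fin d, partialDeriv (Sum.inr i) (partialDeriv (Sum.inr i) φ) z

/-- `g ∈ C([0, ∞); L²(ℝ^{2d}))` is the (weak) solution of the Kolmogorov equation
`(∂_t + v · ∇_x - Δ_v) g = 0` with initial datum `g₀`: for every `φ ∈ C_c^∞(ℝ^{2d})` and `t ≥ 0`,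
`∫ g(t) φ = ∫ g₀ φ + ∫_0^t ∫ g(s) (v · ∇_x φ + Δ_v φ) ds`.
The values of `g` at negative times are irrelevant. -/
structure IsKolmogorovSolution {d : ℕ} (g₀ : PhaseL2 d) (g : ℝ → PhaseL2 d) : Prop where
  continuousOn : ContinuousOn g (Set.Ici 0)
  initial : g 0 = g₀
  weak : ∀ φ : PhaseSpace d → ℂ, ContDiff ℝ ((⊤ : ℕ∞) : WithTop ℕ∞) φ → HasCompactSupport φ →
    ∀ t : ℝ, 0 ≤ t →
    ∫ z, g t z * φ z = (∫ z, g₀ z * φ z) + ∫ s in (0 : ℝ)..t, ∫ z, g s z * kolmogorovAdjoint φ z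

/-- The norm `‖f‖_{L²(ω)}` of the restriction to `ω` of a function `f ∈ L²(ℝ^{2d})`. -/
def l2NormOn {d : ℕ} (ω : Set (PhaseSpace d)) (f : PhaseL2 d) : ℝ :=
  (eLpNorm f 2 (volume.restrict ω)).toReal

end

open MeasureTheory
open scoped Nat

noncomputable section

/-! Two facts are combined: functions with exponentially decaying Fourier transform can be recovered
quantitatively from an observability open set, and the Kolmogorov flow gains a Gaussian factor in
frequency at a cost that is cubic in 1/time.

Unique continuation (`IsObservabilityOpenSet.exists_norm_le_of_fourier_decay`). Cut space into
cubes, each containing a ball of `ω` centred in the cube. A value f(x) is extrapolated along the ray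
from that centre b to x: it equals a combination of m + 1 values f(b + s_j (x - b)), with s_j so
small that these points lie in `ω`, plus an integral of the derivative of order m + 1 along the ray.
Integration in x costs only Jacobians σ^(-n), because each contraction maps its cube into itself.
With f^ = e^(-a|ζ|) k, Plancherel and |ζ|^(m+1) e^(-a|ζ|) ≤ (m+1)!/a^(m+1) cancel the factorial in
the Peano kernel. For a large, depending only on `ω` and the dimension, this yields ‖f‖ ≤ A^(m+1)
‖f‖_ω + 2^(-(m+1)) ‖k‖ with m free.

Smoothing (`IsKolmogorovSolution.fourier_ae_eq`, `phaseFwd_lower`). In frequency the equation is a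
transport equation with damping, so g^(t) is the initial datum composed with a measure-preserving
shear, times exp(-4π² ∫₀ᵗ |η + σξ|² dσ). For t ≤ 1 the integral is at least t³/16 times |ζ|², hence
e^(a|ζ|) g^(t) is bounded by e^(K/t³) times the initial norm. Together these give the estimate in
`IsObservabilityOpenSet.exists_interpolation`.

Telescoping (`exists_telescoping_estimate`). At a right density point ℓ of the time set, apply this
estimate along times t_k = ℓ + q^k h decreasing to ℓ, with m of order (t_k - t_(k+1))^(-3). Weights
exp(-μ/τ_k³) make the inequalities telescope, and the last term vanishes in the limit. The cube in
the exponent becomes 1/T³ in the observability constant. -/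

/-! ### Polynomial extrapolation and its Peano kernel. -/

lemma prod_erase_abs_sub (m : ℕ) (j : Fin (m + 1)) :
    ∏ i ∈ Finset.univ.erase j, |((j : ℕ) : ℝ) - ((i : ℕ) : ℝ)| = (j : ℕ)! * (m - (j : ℕ))! := by
  have hj : (j : ℕ) ≤ m := by omega
  have key : ∀ f : ℕ → ℝ, ∏ i ∈ Finset.univ.erase j, f (i : ℕ)
      = (∏ i ∈ Finset.range (j : ℕ), f i) * ∏ i ∈ Finset.range (m - j), f (j + 1 + i) := by
    intro f
    have h1 : ∏ i ∈ Finset.univ.erase j, f (i : ℕ)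
        = ∏ i ∈ (Finset.range (m + 1)).erase (j : ℕ), f i := by
      refine Finset.prod_bij (fun i _ => (i : ℕ)) ?_ ?_ ?_ ?_
      · intro a ha
        simp only [Finset.mem_erase, Finset.mem_univ, and_true, Finset.mem_range] at ha ⊢
        exact ⟨fun h => ha (Fin.ext h), a.2⟩
      · intro a _ b _ h
        exact Fin.ext h
      · intro b hb
        simp only [Finset.mem_erase, Finset.mem_range] at hb
        exact ⟨⟨b, hb.2⟩, by simpa [Fin.ext_iff] using hb.1, rfl⟩
      · intros; rfl
    have h2 : (Finset.range (m + 1)).erase (j : ℕ)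
        = Finset.range (j : ℕ) ∪ Finset.Ico ((j : ℕ) + 1) (m + 1) := by
      ext i
      simp only [Finset.mem_erase, Finset.mem_range, Finset.mem_union, Finset.mem_Ico]
      omega
    rw [h1, h2, Finset.prod_union, Finset.prod_Ico_eq_prod_range]
    · congr 2
      congr 1
      omega
    · rw [Finset.disjoint_left]
      intro i hi
      simp only [Finset.mem_range, Finset.mem_Ico] at hi ⊢
      omega
  rw [key fun i => |((j : ℕ) : ℝ) - (i : ℝ)|]
  congr 1
  · rw [← Finset.prod_range_reflect, ← Finset.prod_range_add_one_eq_factorial]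
    push_cast
    refine Finset.prod_congr rfl fun i hi => ?_
    have hi' : i < (j : ℕ) := Finset.mem_range.1 hi
    rw [show (j : ℕ) - 1 - i = (j : ℕ) - (1 + i) by omega, Nat.cast_sub (by omega)]
    push_cast
    rw [abs_of_nonneg (by linarith)]
    ring
  · rw [← Finset.prod_range_add_one_eq_factorial]
    push_cast
    refine Finset.prod_congr rfl fun i _ => ?_
    rw [show ((j : ℕ) : ℝ) - ((j : ℕ) + 1 + (i : ℝ)) = -((i : ℝ) + 1) by ring, abs_neg,
      abs_of_nonneg (by positivity)]

/-- Extrapolation to `1` of polynomials of degree at most `m` from nodes in `[ε, 2 ε]`. -/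
lemma exists_extrapolation_coeff (m : ℕ) {ε : ℝ} (hε : 0 < ε) (hε1 : 2 * ε ≤ 1) :
    ∃ c s : Fin (m + 1) → ℝ, (∀ j, ε ≤ s j ∧ s j ≤ 2 * ε) ∧
      ∑ j, |c j| ≤ (2 * Real.exp 1 / ε) ^ (m + 1) ∧
      ∀ k ≤ m, ∑ j, c j * (s j - ε) ^ k = (1 - ε) ^ k := by
  -- Equally spaced nodes; the denominator m + 1, rather than m, makes sense for m = 0 as well.
  set s : Fin (m + 1) → ℝ := fun j => ε + ε * ((j : ℕ) : ℝ) / (m + 1) with hs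
  have hm : (0 : ℝ) < m + 1 := by positivity
  have hs1 : ∀ j, ε ≤ s j ∧ s j ≤ 2 * ε := by
    intro j
    have hj : ((j : ℕ) : ℝ) ≤ m + 1 := by exact_mod_cast j.2.le
    refine ⟨by simp only [hs]; linarith [show 0 ≤ ε * ((j : ℕ) : ℝ) / (m + 1) by positivity], ?_⟩
    have : ε * ((j : ℕ) : ℝ) / (m + 1) ≤ ε := by
      rw [div_le_iff₀ hm]; gcongr
    simp only [hs]; linarith
  have hdiff : ∀ i j, s i - s j = ε / (m + 1) * (((i : ℕ) : ℝ) - ((j : ℕ) : ℝ)) := by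
    intro i j; simp only [hs]; field_simp; ring
  have hinj : Set.InjOn s (Finset.univ : Finset (Fin (m + 1))) := by
    intro i _ j _ h
    have h1 := hdiff i j
    rw [sub_eq_zero.2 h] at h1
    have h2 : ((i : ℕ) : ℝ) - ((j : ℕ) : ℝ) = 0 := by
      rcases mul_eq_zero.1 h1.symm with h | h
      · exact absurd h (by positivity)
      · exact h
    exact Fin.ext (by exact_mod_cast sub_eq_zero.1 h2)
  -- The weights are Lagrange basis polynomials at 1, so exactness is Lagrange interpolation. Their
  -- numerators are at most 1 and their denominators produce j! (m-j)!; with (m+1)^m / m! ≤ e^(m+1)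
  -- each weight is at most a binomial coefficient times (e/ε)^(m+1), and the binomial coefficients
  -- sum to 2^m.
  refine ⟨fun j => (Lagrange.basis Finset.univ s j).eval 1, s, hs1, ?_, ?_⟩
  · have hb : ∀ j, |(Lagrange.basis Finset.univ s j).eval 1|
        ≤ (m.choose j : ℝ) * (Real.exp 1 / ε) ^ (m + 1) := by
      intro j
      have hj : (j : ℕ) ≤ m := by omega
      rw [Lagrange.basis, Polynomial.eval_prod, Finset.abs_prod]
      have h1 : ∀ i ∈ Finset.univ.erase j, |(Lagrange.basisDivisor (s j) (s i)).eval 1|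
          ≤ ((m + 1) / ε) * |((j : ℕ) : ℝ) - ((i : ℕ) : ℝ)|⁻¹ := by
        intro i _
        simp only [Lagrange.basisDivisor, Polynomial.eval_mul, Polynomial.eval_C,
          Polynomial.eval_sub, Polynomial.eval_X]
        rw [abs_mul, abs_inv, hdiff, abs_mul, abs_of_pos (by positivity : 0 < ε / (m + 1)),
          mul_inv, inv_div]
        have : |1 - s i| ≤ 1 := by
          rw [abs_le]; constructor <;> linarith [(hs1 i).1, (hs1 i).2]
        calc _ ≤ (((m : ℝ) + 1) / ε * |((j : ℕ) : ℝ) - ((i : ℕ) : ℝ)|⁻¹) * 1 := by gcongr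
          _ = _ := mul_one _
      refine (Finset.prod_le_prod (fun _ _ => abs_nonneg _) h1).trans ?_
      rw [Finset.prod_mul_distrib, Finset.prod_const, Finset.prod_inv_distrib,
        prod_erase_abs_sub, Finset.card_erase_of_mem (Finset.mem_univ _), Finset.card_univ,
        Fintype.card_fin, Nat.add_sub_cancel]
      have h2 : ((m : ℝ) + 1) ^ m / m ! ≤ Real.exp 1 ^ (m + 1) := by
        have := Real.pow_div_factorial_le_exp ((m : ℝ) + 1) (by positivity) m
        rw [← Real.exp_nat_mul]
        simpa using this
      have h3 : (m.choose j : ℝ) = m ! / ((j : ℕ)! * (m - (j : ℕ))!) := by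
        rw [Nat.choose_eq_factorial_div_factorial hj,
          Nat.cast_div (Nat.factorial_mul_factorial_dvd_factorial hj) (by positivity)]
        push_cast; rfl
      have h4 : (1 / ε) ^ m ≤ (1 / ε) ^ (m + 1) := by
        apply pow_le_pow_right₀ _ (Nat.le_succ m)
        rw [le_div_iff₀ hε]; linarith
      calc _ = (m.choose j : ℝ) * ((((m : ℝ) + 1) ^ m / m !) * (1 / ε) ^ m) := by
            rw [h3, div_pow, div_pow, one_pow]; field_simp
        _ ≤ (m.choose j : ℝ) * (Real.exp 1 ^ (m + 1) * (1 / ε) ^ (m + 1)) := by gcongr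
        _ = _ := by rw [← mul_pow]; congr 2; ring
    calc _ ≤ ∑ j : Fin (m + 1), (m.choose j : ℝ) * (Real.exp 1 / ε) ^ (m + 1) :=
          Finset.sum_le_sum fun j _ => hb j
      _ = (2 : ℝ) ^ m * (Real.exp 1 / ε) ^ (m + 1) := by
          rw [← Finset.sum_mul, Fin.sum_univ_eq_sum_range (fun j => (m.choose j : ℝ))]
          congr 1
          exact_mod_cast Nat.sum_range_choose m
      _ ≤ (2 : ℝ) ^ (m + 1) * (Real.exp 1 / ε) ^ (m + 1) := by
          gcongr <;> simp
      _ = _ := by rw [← mul_pow]; congr 1; ring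
  · intro k hk
    have hdeg : ((Polynomial.X - Polynomial.C ε) ^ k).degree
        < ((Finset.univ : Finset (Fin (m + 1))).card : WithBot ℕ) := by
      rw [Polynomial.degree_pow, Polynomial.degree_X_sub_C, Finset.card_univ, Fintype.card_fin]
      simp only [nsmul_eq_mul, mul_one]
      exact_mod_cast Nat.lt_succ_of_le hk
    have := congrArg (Polynomial.eval 1) (Lagrange.eq_interpolate hinj hdeg)
    rw [Lagrange.interpolate_apply, Polynomial.eval_finsetSum] at this
    simp only [Polynomial.eval_pow, Polynomial.eval_sub, Polynomial.eval_X, Polynomial.eval_C,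
      Polynomial.eval_mul] at this
    rw [this]
    exact Finset.sum_congr rfl fun j _ => mul_comm _ _

lemma iteratedDeriv_cexp_mul_ofReal (z : ℂ) (k : ℕ) :
    iteratedDeriv k (fun s : ℝ => Complex.exp (z * s)) = fun s : ℝ => z ^ k * Complex.exp (z * s) := by
  induction k with
  | zero => ext s; simp
  | succ k ih =>
    rw [iteratedDeriv_succ, ih]
    ext s
    have h : HasDerivAt (fun s : ℝ => z ^ k * Complex.exp (z * s))
        (z ^ k * (Complex.exp (z * s) * (z * 1))) s := by
      have h1 : HasDerivAt (fun s : ℝ => z * (s : ℂ)) (z * 1) s :=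
        (Complex.ofRealCLM.hasDerivAt (x := s)).const_mul z
      exact (h1.cexp).const_mul _
    rw [h.deriv]; ring

/-- The integral form of the remainder is what makes the extrapolation error linear in the
derivative of order m + 1, with a kernel independent of z. -/
lemma cexp_taylor (z : ℂ) (m : ℕ) {a s : ℝ} (has : a ≤ s) :
    Complex.exp (z * s) = (∑ k ∈ Finset.range (m + 1),
        ((s - a) ^ k : ℝ) • (((k ! : ℝ)⁻¹ : ℝ) • (z ^ k * Complex.exp (z * a))))
      + ∫ σ in a..s, ((s - σ) ^ m / m ! : ℝ) • (z ^ (m + 1) * Complex.exp (z * σ)) := by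
  rcases has.eq_or_lt with rfl | hlt
  · rw [intervalIntegral.integral_same, add_zero, Finset.sum_eq_single 0]
    · simp
    · intro b _ hb; simp [hb]
    · simp
  have hC : ∀ n : ℕ, ContDiff ℝ n (fun s : ℝ => Complex.exp (z * s)) := by
    intro n
    exact (contDiff_const.mul Complex.ofRealCLM.contDiff).cexp
  have huniq : UniqueDiffOn ℝ (Set.uIcc a s) := uniqueDiffOn_uIcc hlt.ne
  have hder : ∀ k, ∀ x ∈ Set.uIcc a s,
      iteratedDerivWithin k (fun s : ℝ => Complex.exp (z * s)) (Set.uIcc a s) x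
        = z ^ k * Complex.exp (z * x) := by
    intro k x hx
    rw [iteratedDerivWithin_eq_iteratedDeriv huniq (hC k).contDiffAt hx,
      iteratedDeriv_cexp_mul_ofReal]
  have h := taylor_integral_remainder (n := m) (hC (m + 1)).contDiffOn (x₀ := a) (x := s)
  rw [taylor_within_apply, sub_eq_iff_eq_add'] at h
  rw [h]
  congr 1
  · refine Finset.sum_congr rfl fun k _ => ?_
    rw [hder k a Set.left_mem_uIcc, mul_comm, mul_smul]
  · refine intervalIntegral.integral_congr fun σ hσ => ?_
    rw [hder _ σ hσ]

/-- Peano kernel representation of the error of an extrapolation formula, for exponentials. -/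
lemma exists_peano_kernel (m : ℕ) {ε : ℝ} (hε : 0 < ε) (hε1 : 2 * ε ≤ 1)
    {c s : Fin (m + 1) → ℝ} (hs : ∀ j, ε ≤ s j ∧ s j ≤ 2 * ε)
    (hc : ∀ k ≤ m, ∑ j, c j * (s j - ε) ^ k = (1 - ε) ^ k) :
    ∃ K : ℝ → ℝ, Measurable K ∧ (∀ σ ∈ Set.Icc ε 1, |K σ| ≤ (1 + ∑ j, |c j|) / m !) ∧
      ∀ z : ℂ, Complex.exp z - ∑ j, (c j : ℂ) * Complex.exp (z * s j)
        = ∫ σ in Set.Ioc ε 1, (K σ : ℂ) * (z ^ (m + 1) * Complex.exp (z * σ)) := by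
  -- The Taylor remainder kernel, extended by zero beyond t so that all remainders are integrals
  -- over the same interval (ε, 1].
  set k : ℝ → ℝ → ℝ := fun t σ => if σ ≤ t then (t - σ) ^ m / m ! else 0 with hk
  have hkm : ∀ t, Measurable (k t) := fun t =>
    Measurable.ite measurableSet_Iic (by fun_prop) measurable_const
  have hkb : ∀ t ≤ 1, ∀ σ ∈ Set.Icc ε 1, |k t σ| ≤ 1 / m ! := by
    intro t ht σ hσ
    simp only [hk]
    split_ifs with h
    · rw [abs_div, abs_pow, Nat.abs_cast]
      gcongr
      apply pow_le_one₀ (abs_nonneg _)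
      rw [abs_of_nonneg (by linarith)]
      linarith [hσ.1]
    · simp
  have hs1 : ∀ j, s j ≤ 1 := fun j => (hs j).2.trans hε1
  refine ⟨fun σ => k 1 σ - ∑ j, c j * k (s j) σ, ?_, ?_, ?_⟩
  · exact (hkm 1).sub (Finset.measurable_sum _ fun j _ => (hkm _).const_mul _)
  · intro σ hσ
    have h1 : |∑ j, c j * k (s j) σ| ≤ ∑ j, |c j| * (1 / m !) := by
      refine (Finset.abs_sum_le_sum_abs _ _).trans (Finset.sum_le_sum fun j _ => ?_)
      rw [abs_mul]
      exact mul_le_mul_of_nonneg_left (hkb _ (hs1 j) σ hσ) (abs_nonneg _)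
    calc _ ≤ |k 1 σ| + |∑ j, c j * k (s j) σ| := abs_sub _ _
      _ ≤ 1 / m ! + ∑ j, |c j| * (1 / m !) := add_le_add (hkb 1 le_rfl σ hσ) h1
      _ = _ := by rw [← Finset.sum_mul]; ring
  · intro z
    set g : ℝ → ℂ := fun σ => z ^ (m + 1) * Complex.exp (z * σ) with hg
    have hgc : Continuous g := by simp only [hg]; fun_prop
    set P : ℝ → ℂ := fun t => ∑ k ∈ Finset.range (m + 1),
        ((t - ε) ^ k : ℝ) • (((k ! : ℝ)⁻¹ : ℝ) • (z ^ k * Complex.exp (z * ε))) with hP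
    have hint : ∀ t ≤ 1, IntegrableOn (fun σ => (k t σ : ℂ) * g σ) (Set.Ioc ε 1) := by
      intro t ht
      have hg1 : IntegrableOn g (Set.Ioc ε 1) := hgc.integrableOn_Ioc
      refine Integrable.bdd_mul (c := 1 / m !) hg1 ?_ ?_
      · exact (Complex.measurable_ofReal.comp (hkm t)).aestronglyMeasurable
      · refine (ae_restrict_iff' measurableSet_Ioc).2 (Filter.Eventually.of_forall fun σ hσ => ?_)
        rw [Complex.norm_real, Real.norm_eq_abs]
        exact hkb t ht σ ⟨hσ.1.le, hσ.2⟩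
    have hrep : ∀ t, ε ≤ t → t ≤ 1 →
        Complex.exp (z * t) = P t + ∫ σ in Set.Ioc ε 1, (k t σ : ℂ) * g σ := by
      intro t ht1 ht2
      rw [cexp_taylor z m ht1, intervalIntegral.integral_of_le ht1]
      congr 1
      have hsub : Set.Ioc ε t ⊆ Set.Ioc ε 1 := Set.Ioc_subset_Ioc_right ht2
      rw [← Set.inter_eq_right.2 hsub, ← setIntegral_indicator measurableSet_Ioc]
      refine setIntegral_congr_fun measurableSet_Ioc fun σ hσ => ?_
      simp only [Set.indicator, hk, Set.mem_Ioc, hσ.1, true_and]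
      split_ifs <;> simp [hg]
    -- The Taylor polynomial at ε has degree at most m, so it is extrapolated exactly and only the
    -- remainders survive.
    have hPc : P 1 - ∑ j, (c j : ℂ) * P (s j) = 0 := by
      simp only [hP, Finset.mul_sum]
      rw [Finset.sum_comm, ← Finset.sum_sub_distrib]
      refine Finset.sum_eq_zero fun i hi => ?_
      have hi' : i ≤ m := Nat.lt_succ_iff.1 (Finset.mem_range.1 hi)
      rw [← hc i hi', Finset.sum_smul, sub_eq_zero]
      refine Finset.sum_congr rfl fun j _ => ?_
      rw [mul_smul, Complex.real_smul (x := c j)]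
    have h1 := hrep 1 (by linarith) le_rfl
    rw [Complex.ofReal_one, mul_one] at h1
    rw [h1]
    simp_rw [fun j => hrep (s j) (hs j).1 (hs1 j), mul_add, Finset.sum_add_distrib]
    rw [add_sub_add_comm, hPc, zero_add]
    simp_rw [← integral_const_mul]
    rw [← integral_finsetSum _ fun j _ => (hint _ (hs1 j)).const_mul _,
      ← integral_sub (hint 1 le_rfl)
        (integrable_finsetSum _ fun j _ => (hint _ (hs1 j)).const_mul _)]
    refine integral_congr_ae (Filter.Eventually.of_forall fun σ => ?_)
    simp only
    push_cast
    rw [sub_mul, Finset.sum_mul]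
    congr 1
    exact Finset.sum_congr rfl fun j _ => by ring

/-! ### The Fourier transform on L². -/

open FourierTransform SchwartzMap in
/-- Duality formula for the Fourier transform on `L²`. -/
lemma integral_fourierLp_mul {V : Type*} [NormedAddCommGroup V] [InnerProductSpace ℝ V]
    [FiniteDimensional ℝ V] [MeasurableSpace V] [BorelSpace V]
    (f : Lp ℂ 2 (volume : Measure V)) (θ : 𝓢(V, ℂ)) :
    ∫ ζ, (𝓕 f : Lp ℂ 2 (volume : Measure V)) ζ * θ ζ = ∫ z, f z * (𝓕 θ) z := by
  have h := congrArg (fun u => u θ) (Lp.fourier_toTemperedDistribution_eq f)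
  simp only [TemperedDistribution.fourier_apply, Lp.toTemperedDistribution_apply,
    smul_eq_mul] at h
  simp_rw [mul_comm _ (θ _), mul_comm _ ((𝓕 θ) _)]
  exact h.symm

open FourierTransform SchwartzMap in
/-- On `L¹ ∩ L²` the `L²` inverse Fourier transform is given by the inverse Fourier integral. -/
lemma fourierInv_ae_eq_fourierInv_toLp {V : Type*} [NormedAddCommGroup V] [InnerProductSpace ℝ V]
    [FiniteDimensional ℝ V] [MeasurableSpace V] [BorelSpace V] {h : V → ℂ}
    (h1 : Integrable h) (h2 : MemLp h 2) :
    𝓕⁻ h =ᵐ[volume] (𝓕⁻ (h2.toLp h) : Lp ℂ 2 (volume : Measure V)) := by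
  have hc : Continuous (𝓕⁻ h) :=
    VectorFourier.fourierIntegral_continuous Real.continuous_fourierChar
      (by simpa using! continuous_inner.neg) h1
  refine ae_eq_of_integral_contDiff_smul_eq hc.locallyIntegrable
    ((Lp.memLp _).locallyIntegrable (by norm_num)) fun g hg hgc => ?_
  have hg₁ : HasCompactSupport (Complex.ofRealCLM ∘ g) := hgc.comp_left rfl
  have hg₂ : ContDiff ℝ ((⊤ : ℕ∞) : WithTop ℕ∞) (Complex.ofRealCLM ∘ g) := by fun_prop
  set G : 𝓢(V, ℂ) := hg₁.toSchwartzMap hg₂ with hG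
  have hGa : ∀ x, G x = (g x : ℂ) := fun x => rfl
  have e1 : ∫ x, g x • (𝓕⁻ (h2.toLp h) : Lp ℂ 2 (volume : Measure V)) x
      = ∫ x, (𝓕⁻ G) x • h x := by
    have := congrArg (fun u => u G) (Lp.fourierInv_toTemperedDistribution_eq (h2.toLp h))
    simp only [TemperedDistribution.fourierInv_apply, Lp.toTemperedDistribution_apply] at this
    have e0 : ∫ x, (𝓕⁻ G) x • (h2.toLp h) x = ∫ x, (𝓕⁻ G) x • h x := by
      refine integral_congr_ae ?_
      filter_upwards [h2.coeFn_toLp] with x hx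
      rw [hx]
    rw [← e0, this]
    refine integral_congr_ae (Filter.Eventually.of_forall fun x => ?_)
    simp [hGa]
  rw [e1]
  have e2 := VectorFourier.integral_fourierIntegral_smul_eq_flip (μ := volume) (ν := volume)
    (L := -innerₗ V) Real.continuous_fourierChar
    (by simpa using! continuous_inner.neg) G.integrable h1
  have hflip : (-innerₗ V).flip = -innerₗ V := by
    ext x y
    simp [real_inner_comm]
  rw [hflip] at e2
  rw [fourierInv_coe G]
  exact e2.symm

open FourierTransform in
/-- Plancherel's theorem for the inverse Fourier integral on `L¹ ∩ L²`. -/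
lemma lintegral_fourierInv_sq {V : Type*} [NormedAddCommGroup V] [InnerProductSpace ℝ V]
    [FiniteDimensional ℝ V] [MeasurableSpace V] [BorelSpace V] {h : V → ℂ}
    (h1 : Integrable h) (h2 : MemLp h 2) :
    ∫⁻ x, ‖𝓕⁻ h x‖ₑ ^ 2 = ∫⁻ x, ‖h x‖ₑ ^ 2 := by
  have e : eLpNorm (𝓕⁻ h) 2 volume = eLpNorm h 2 volume := by
    rw [eLpNorm_congr_ae (fourierInv_ae_eq_fourierInv_toLp h1 h2), ← Lp.enorm_def,
      ← eLpNorm_congr_ae h2.coeFn_toLp, ← Lp.enorm_def, enorm_eq_iff_norm_eq]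
    exact (Lp.fourierTransformₗᵢ V ℂ).symm.norm_map _
  have key : ∀ f : V → ℂ, ∫⁻ x, ‖f x‖ₑ ^ 2 = eLpNorm f 2 volume ^ 2 := by
    intro f
    have := eLpNorm_nnreal_pow_eq_lintegral (f := f) (μ := (volume : Measure V)) (p := 2) (by norm_num)
    simpa using this.symm
  rw [key, key, e]

-- Extrapolation evaluates functions at points, so an L² class is replaced by the continuous
-- representative that an integrable Fourier transform provides.
open FourierTransform in
lemma ae_eq_fourierInv_of_fourier_ae_eq {V : Type*} [NormedAddCommGroup V] [InnerProductSpace ℝ V]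
    [FiniteDimensional ℝ V] [MeasurableSpace V] [BorelSpace V] {h : V → ℂ}
    (f : Lp ℂ 2 (volume : Measure V)) (h1 : Integrable h)
    (hf : (𝓕 f : Lp ℂ 2 (volume : Measure V)) =ᵐ[volume] h) : f =ᵐ[volume] 𝓕⁻ h := by
  have h2 : MemLp h 2 := (memLp_congr_ae hf).1 (Lp.memLp _)
  have e : h2.toLp h = 𝓕 f := by
    apply Lp.ext
    exact h2.coeFn_toLp.trans hf.symm
  have := fourierInv_ae_eq_fourierInv_toLp h1 h2
  rw [e, fourierInv_fourier_eq] at this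
  exact this.symm

/-! ### Contraction of cells towards centres. -/

lemma lintegral_comp_homothety {V : Type*} [NormedAddCommGroup V] [NormedSpace ℝ V]
    [FiniteDimensional ℝ V] [MeasurableSpace V] [BorelSpace V] (μ : Measure V)
    [μ.IsAddHaarMeasure] (b : V) {σ : ℝ} (hσ : 0 < σ) {G : V → ENNReal} (hG : Measurable G) :
    ∫⁻ x, G (b + σ • (x - b)) ∂μ
      = ENNReal.ofReal ((σ ^ Module.finrank ℝ V)⁻¹) * ∫⁻ x, G x ∂μ := by
  have h1 : ∫⁻ x, G (b + σ • (x - b)) ∂μ = ∫⁻ x, G (b + σ • x) ∂μ :=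
    lintegral_sub_right_eq_self (fun x => G (b + σ • x)) b
  have h2 : ∫⁻ x, G (b + σ • x) ∂μ = ∫⁻ x, G (b + x) ∂(μ.map (σ • ·)) := by
    rw [lintegral_map (by fun_prop) (by fun_prop)]
  rw [h1, h2, Measure.map_addHaar_smul μ hσ.ne', lintegral_smul_measure,
    lintegral_add_left_eq_self, smul_eq_mul, abs_of_nonneg (by positivity)]

/-- Contracting each cell of a countable partition towards one of its points increases lower
integrals by at most the Jacobian factor. -/
lemma lintegral_comp_cellwise_homothety_le {V : Type*} [NormedAddCommGroup V] [NormedSpace ℝ V]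
    [FiniteDimensional ℝ V] [MeasurableSpace V] [BorelSpace V] (μ : Measure V)
    [μ.IsAddHaarMeasure] {κ : Type*} [Countable κ] {q : V → κ}
    (hq : ∀ k, MeasurableSet (q ⁻¹' {k})) (b : κ → V) {σ : ℝ} (hσ : 0 < σ)
    (hstar : ∀ x, q (b (q x) + σ • (x - b (q x))) = q x) {G : V → ENNReal} (hG : Measurable G) :
    ∫⁻ x, G (b (q x) + σ • (x - b (q x))) ∂μ
      ≤ ENNReal.ofReal ((σ ^ Module.finrank ℝ V)⁻¹) * ∫⁻ x, G x ∂μ := by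
  have hU : ⋃ k, q ⁻¹' {k} = Set.univ := by
    ext x; simp
  have hdisj : Pairwise (Function.onFun Disjoint fun k => q ⁻¹' {k}) := by
    intro i j hij
    exact Disjoint.preimage _ (Set.disjoint_singleton.2 hij)
  have hsum : ∀ H : V → ENNReal, ∫⁻ x, H x ∂μ = ∑' k, ∫⁻ x in q ⁻¹' {k}, H x ∂μ := by
    intro H
    rw [← lintegral_iUnion hq hdisj, hU, setLIntegral_univ]
  rw [hsum, hsum G, ← ENNReal.tsum_mul_left]
  refine ENNReal.tsum_le_tsum fun k => ?_
  -- On the cell k the map is a single homothety that keeps the cell invariant, so G may be replaced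
  -- by its restriction to the cell before the homothety is extended to the whole space.
  rw [← lintegral_indicator (hq k) G, ← lintegral_comp_homothety μ (b k) hσ (hG.indicator (hq k)),
    ← lintegral_indicator (hq k)]
  refine lintegral_mono fun x => ?_
  by_cases hx : q x = k
  · subst hx
    have h1 : x ∈ q ⁻¹' {q x} := rfl
    have h2 : b (q x) + σ • (x - b (q x)) ∈ q ⁻¹' {q x} := hstar x
    rw [Set.indicator_of_mem h1, Set.indicator_of_mem h2]
  · rw [Set.indicator_of_notMem (by simpa using hx)]
    exact zero_le

/-- A set of centres for an observability open set: every point `x` is contracted towards a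
nearby point `β x`, and after contraction by a small factor it lands in the set. -/
lemma IsObservabilityOpenSet.exists_centres {ι : Type*} [Fintype ι]
    {ω : Set (EuclideanSpace ℝ ι)} (hω : IsObservabilityOpenSet ω) :
    ∃ D : ℝ, 0 < D ∧ ∃ ε : ℝ, 0 < ε ∧ 2 * ε ≤ 1 ∧ ∃ β : EuclideanSpace ℝ ι → EuclideanSpace ℝ ι,
      Measurable β ∧ (∀ x, ‖x - β x‖ ≤ D) ∧
      (∀ x, ∀ s : ℝ, 0 ≤ s → s ≤ 2 * ε → β x + s • (x - β x) ∈ ω) ∧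
      ∀ σ : ℝ, 0 < σ → σ ≤ 1 → ∀ G : EuclideanSpace ℝ ι → ENNReal, Measurable G →
        ∫⁻ x, G (β x + σ • (x - β x)) ≤ ENNReal.ofReal ((σ ^ Fintype.card ι)⁻¹) * ∫⁻ x, G x := by
  obtain ⟨-, δ, hδ, r, hr, hb⟩ := hω
  -- Half the side of the cubes exceeds δ, so the point of `ω` found near the centre of a cube lies
  -- in that cube. Cubes being convex, contraction towards this point preserves them.
  set L : ℝ := 2 * δ + 1 with hL
  have hL0 : 0 < L := by positivity
  choose c hc using fun k : ι → ℤ => hb (WithLp.toLp 2 fun i => L * ((k i : ℝ) + 1 / 2))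
  set q : EuclideanSpace ℝ ι → (ι → ℤ) := fun x i => ⌊x i / L⌋ with hq
  have hqiff : ∀ x k, q x = k ↔ ∀ i, L * (k i : ℝ) ≤ x i ∧ x i < L * ((k i : ℝ) + 1) := by
    intro x k
    rw [funext_iff]
    refine forall_congr' fun i => ?_
    rw [hq, Int.floor_eq_iff, le_div_iff₀ hL0, div_lt_iff₀ hL0, mul_comm L, mul_comm L]
  have hqm : Measurable q := by
    refine measurable_pi_lambda _ fun i => Int.measurable_floor.comp ?_
    fun_prop
  have hqs : ∀ k, MeasurableSet (q ⁻¹' {k}) := fun k => hqm (measurableSet_singleton k)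
  have hcq : ∀ k, q (c k) = k := by
    intro k
    rw [hqiff]
    intro i
    have h1 := (PiLp.norm_apply_le (c k - WithLp.toLp 2 fun i => L * ((k i : ℝ) + 1 / 2)) i).trans
      ((dist_eq_norm _ _).symm.trans_le ((dist_comm _ _).trans_le (hc k).2.2))
    rw [Real.norm_eq_abs, abs_le] at h1
    simp only [PiLp.sub_apply] at h1
    constructor <;> nlinarith [h1.1, h1.2]
  set n : ℝ := (Fintype.card ι : ℝ) with hn
  set D : ℝ := Real.sqrt n * L + 1 with hD
  have hD0 : 0 < D := by positivity
  have hdist : ∀ x, ‖x - c (q x)‖ ≤ D := by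
    intro x
    have h1 := (hqiff x _).1 rfl
    have h2 := (hqiff (c (q x)) _).1 (hcq _)
    rw [EuclideanSpace.norm_eq]
    have : ∑ i, ‖(x - c (q x)) i‖ ^ 2 ≤ n * L ^ 2 := by
      calc _ ≤ ∑ _i : ι, L ^ 2 := by
            refine Finset.sum_le_sum fun i _ => ?_
            rw [Real.norm_eq_abs, sq_abs, ← sq_abs]
            gcongr
            rw [abs_le, PiLp.sub_apply]
            constructor <;> nlinarith [(h1 i).1, (h1 i).2, (h2 i).1, (h2 i).2]
        _ = n * L ^ 2 := by simp [hn]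
    calc _ ≤ Real.sqrt (n * L ^ 2) := Real.sqrt_le_sqrt this
      _ = Real.sqrt n * L := by
        rw [Real.sqrt_mul (by positivity), Real.sqrt_sq hL0.le]
      _ ≤ D := by simp [hD]
  -- For s ≤ 2ε the contracted point is within 2εD ≤ r/2 of the centre, hence in the ball of radius
  -- r inside `ω`.
  refine ⟨D, hD0, min (1 / 2) (r / (4 * D)), by positivity, ?_, fun x => c (q x), ?_, hdist, ?_, ?_⟩
  · linarith [min_le_left (1 / 2) (r / (4 * D))]
  · exact (measurable_of_countable c).comp hqm
  · intro x s hs0 hs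
    apply (hc (q x)).2.1
    rw [Metric.mem_ball, dist_eq_norm, add_sub_cancel_left, norm_smul, Real.norm_eq_abs,
      abs_of_nonneg hs0]
    have h1 : s ≤ r / (2 * D) := by
      refine hs.trans ?_
      calc _ ≤ 2 * (r / (4 * D)) := by gcongr; exact min_le_right _ _
        _ = _ := by field_simp; norm_num
    calc s * ‖x - c (q x)‖ ≤ r / (2 * D) * D := by
          gcongr
          exact hdist x
      _ = r / 2 := by field_simp
      _ < r := by linarith
  · intro σ hσ hσ1 G hG
    have := lintegral_comp_cellwise_homothety_le (volume : Measure (EuclideanSpace ℝ ι)) hqs c hσ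
      ?_ hG
    · simpa using this
    · intro x
      rw [hqiff]
      intro i
      have h1 := (hqiff x _).1 rfl i
      have h2 := (hqiff (c (q x)) _).1 (hcq _) i
      simp only [PiLp.add_apply, PiLp.smul_apply, PiLp.sub_apply, smul_eq_mul]
      constructor <;> nlinarith [h1.1, h1.2, h2.1, h2.2]

/-! ### Quantitative unique continuation. -/

/-- One term of the exponential series is at most its sum. The factorial is the price of m
derivatives under exponential decay, and the Peano kernel pays for it. -/
lemma pow_mul_exp_neg_le {a x : ℝ} (ha : 0 < a) (hx : 0 ≤ x) (m : ℕ) :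
    x ^ m * Real.exp (-(a * x)) ≤ m ! / a ^ m := by
  have h := Real.pow_div_factorial_le_exp (a * x) (by positivity) m
  rw [Real.exp_neg, ← div_eq_mul_inv, div_le_div_iff₀ (Real.exp_pos _) (by positivity)]
  rw [div_le_iff₀ (by positivity), mul_pow] at h
  linarith

/-- Paired with an L² function k, this makes |ζ|^j e^(-a|ζ|) k integrable, so Fourier integrals and
all their derivatives can be taken pointwise. -/
lemma memLp_two_norm_pow_mul_exp_neg {V : Type*} [NormedAddCommGroup V] [NormedSpace ℝ V]
    [FiniteDimensional ℝ V] [MeasurableSpace V] [BorelSpace V] (μ : Measure V)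
    [μ.IsAddHaarMeasure] {a : ℝ} (ha : 0 < a) (j : ℕ) :
    MemLp (fun x : V => ‖x‖ ^ j * Real.exp (-(a * ‖x‖))) 2 μ := by
  have hc : Continuous fun x : V => ‖x‖ ^ j * Real.exp (-(a * ‖x‖)) := by fun_prop
  rw [memLp_two_iff_integrable_sq hc.aestronglyMeasurable]
  set r : ℕ := Module.finrank ℝ V + 1 with hr
  have hi := integrable_one_add_norm (E := V) (μ := μ) (r := (r : ℝ)) (by simp [hr])
  refine (hi.const_mul ((2 * j + r)! / a ^ (2 * j + r) * Real.exp a)).mono'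
    (hc.pow 2).aestronglyMeasurable (Filter.Eventually.of_forall fun x => ?_)
  rw [Real.norm_eq_abs, abs_of_nonneg (by positivity), Real.rpow_neg (by positivity),
    Real.rpow_natCast, ← div_eq_mul_inv, le_div_iff₀ (by positivity), mul_pow, ← pow_mul]
  have h1 := pow_mul_exp_neg_le ha (by positivity : 0 ≤ 1 + ‖x‖) (2 * j + r)
  have h2 : Real.exp (-(a * ‖x‖)) ^ 2 ≤ Real.exp (-(a * (1 + ‖x‖))) * Real.exp a := by
    rw [sq, ← Real.exp_add, ← Real.exp_add, Real.exp_le_exp]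
    nlinarith [norm_nonneg x, mul_nonneg ha.le (norm_nonneg x)]
  calc ‖x‖ ^ (j * 2) * Real.exp (-(a * ‖x‖)) ^ 2 * (1 + ‖x‖) ^ r
      ≤ (1 + ‖x‖) ^ (2 * j) * (Real.exp (-(a * (1 + ‖x‖))) * Real.exp a) * (1 + ‖x‖) ^ r := by
        rw [mul_comm j 2]
        gcongr
        linarith
    _ = (1 + ‖x‖) ^ (2 * j + r) * Real.exp (-(a * (1 + ‖x‖))) * Real.exp a := by ring
    _ ≤ _ := by gcongr

open FourierTransform in
/-- Extrapolation formula for an inverse Fourier integral along a ray issued from `p`. -/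
lemma fourierInv_extrapolation {ι : Type*} [Fintype ι] {h : EuclideanSpace ℝ ι → ℂ} (m : ℕ)
    (h0 : Integrable h) (h1 : Integrable fun ζ => (‖ζ‖ ^ (m + 1) : ℝ) * h ζ)
    {ε : ℝ} {c s : Fin (m + 1) → ℝ} {K : ℝ → ℝ} (hK : Measurable K) {κ : ℝ}
    (hKb : ∀ σ ∈ Set.Icc ε 1, |K σ| ≤ κ)
    (hrep : ∀ z : ℂ, Complex.exp z - ∑ j, (c j : ℂ) * Complex.exp (z * s j)
        = ∫ σ in Set.Ioc ε 1, (K σ : ℂ) * (z ^ (m + 1) * Complex.exp (z * σ)))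
    (p u : EuclideanSpace ℝ ι) :
    𝓕⁻ h (p + u) - ∑ j, (c j : ℂ) * 𝓕⁻ h (p + s j • u)
      = ∫ σ in Set.Ioc ε 1, (K σ : ℂ) * ∑ w : Fin (m + 1) → ι, ((∏ i, u (w i) : ℝ) : ℂ) *
          𝓕⁻ (fun ζ => (2 * Real.pi * Complex.I) ^ (m + 1) * ((∏ i, ζ (w i) : ℝ) : ℂ) * h ζ)
            (p + σ • u) := by
  have hFI : ∀ (g : EuclideanSpace ℝ ι → ℂ) (σ : ℝ), 𝓕⁻ g (p + σ • u)
      = ∫ ζ, Complex.exp (2 * Real.pi * Complex.I * (inner ℝ ζ p : ℝ)) *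
          Complex.exp (2 * Real.pi * Complex.I * (inner ℝ ζ u : ℝ) * σ) * g ζ := by
    intro g σ
    rw [Real.fourierInv_eq']
    refine integral_congr_ae (Filter.Eventually.of_forall fun ζ => ?_)
    simp only [smul_eq_mul]
    rw [← Complex.exp_add, inner_add_right, inner_smul_right]
    push_cast
    congr 2
    ring
  have hmb : ∀ z : EuclideanSpace ℝ ι, ∀ t : ℝ, ∀ ζ : EuclideanSpace ℝ ι,
      ‖Complex.exp (2 * Real.pi * Complex.I * (inner ℝ ζ z : ℝ) * t)‖ = 1 := by
    intro z t ζ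
    rw [show 2 * Real.pi * Complex.I * (inner ℝ ζ z : ℝ) * t
      = ((2 * Real.pi * inner ℝ ζ z * t : ℝ) : ℂ) * Complex.I by push_cast; ring]
    exact Complex.norm_exp_ofReal_mul_I _
  have hmb' : ∀ ζ : EuclideanSpace ℝ ι,
      ‖Complex.exp (2 * Real.pi * Complex.I * (inner ℝ ζ p : ℝ))‖ = 1 := by
    intro ζ
    simpa using hmb p 1 ζ
  have hint : ∀ σ : ℝ, Integrable fun ζ =>
      Complex.exp (2 * Real.pi * Complex.I * (inner ℝ ζ p : ℝ)) *
          Complex.exp (2 * Real.pi * Complex.I * (inner ℝ ζ u : ℝ) * σ) * h ζ := by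
    intro σ
    refine h0.bdd_mul (c := 1) ?_ (Filter.Eventually.of_forall fun ζ => ?_)
    · exact Continuous.aestronglyMeasurable (by fun_prop)
    · rw [norm_mul, hmb, hmb', one_mul]
  have hw : ∀ w : Fin (m + 1) → ι, Integrable fun ζ : EuclideanSpace ℝ ι =>
      (2 * Real.pi * Complex.I) ^ (m + 1) * ((∏ i, ζ (w i) : ℝ) : ℂ) * h ζ := by
    intro w
    refine (h1.norm.const_mul ((2 * Real.pi) ^ (m + 1))).mono' ?_
      (Filter.Eventually.of_forall fun ζ => ?_)
    · refine AEStronglyMeasurable.mul ?_ h0.1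
      refine Continuous.aestronglyMeasurable ?_
      have : Continuous fun ζ : EuclideanSpace ℝ ι => ∏ i, ζ (w i) := by fun_prop
      fun_prop
    · have hz : |∏ i, ζ (w i)| ≤ ‖ζ‖ ^ (m + 1) := by
        rw [Finset.abs_prod]
        calc _ ≤ ∏ _i : Fin (m + 1), ‖ζ‖ :=
              Finset.prod_le_prod (fun _ _ => abs_nonneg _) fun i _ => PiLp.norm_apply_le ζ (w i)
          _ = _ := by simp
      simp only [norm_mul, norm_pow, Complex.norm_real, Complex.norm_I, Real.norm_eq_abs,
        Complex.norm_ofNat, mul_one, abs_of_pos Real.pi_pos, abs_norm]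
      rw [mul_assoc]
      gcongr
  have e1 : 𝓕⁻ h (p + u) = ∫ ζ, Complex.exp (2 * Real.pi * Complex.I * (inner ℝ ζ p : ℝ)) *
          Complex.exp (2 * Real.pi * Complex.I * (inner ℝ ζ u : ℝ)) * h ζ := by
    simpa using hFI h 1
  have hint1 := hint 1
  simp only [Complex.ofReal_one, mul_one] at hint1
  rw [e1]
  simp_rw [hFI, ← integral_const_mul]
  rw [← integral_finsetSum _ fun j _ => (hint _).const_mul _,
    ← integral_sub hint1 (integrable_finsetSum _ fun j _ => (hint _).const_mul _)]
  set z : EuclideanSpace ℝ ι → ℂ := fun ζ => 2 * Real.pi * Complex.I * (inner ℝ ζ u : ℝ) with hz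
  set e : EuclideanSpace ℝ ι → ℂ :=
    fun ζ => Complex.exp (2 * Real.pi * Complex.I * (inner ℝ ζ p : ℝ)) with he
  -- Expanding the power of the inner product separates u, which depends on x in the application,
  -- from ζ. Words w replace multi-indices, so no multinomial coefficients occur.
  have hzpow : ∀ ζ, z ζ ^ (m + 1) = ∑ w : Fin (m + 1) → ι, ((∏ i, u (w i) : ℝ) : ℂ) *
      ((2 * Real.pi * Complex.I) ^ (m + 1) * ((∏ i, ζ (w i) : ℝ) : ℂ)) := by
    intro ζ
    simp only [hz]
    rw [mul_pow, ← Complex.ofReal_pow, PiLp.inner_apply, Fintype.sum_pow, Complex.ofReal_sum,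
      Finset.mul_sum]
    refine Finset.sum_congr rfl fun w _ => ?_
    simp only [RCLike.inner_apply, conj_trivial]
    rw [Finset.prod_mul_distrib]
    push_cast
    ring
  have e2 : ∀ ζ, e ζ * Complex.exp (z ζ) * h ζ
        - ∑ j, (c j : ℂ) * (e ζ * Complex.exp (z ζ * s j) * h ζ)
      = ∫ σ in Set.Ioc ε 1, (K σ : ℂ) * (e ζ * Complex.exp (z ζ * σ)) * (z ζ ^ (m + 1) * h ζ) := by
    intro ζ
    calc _ = (Complex.exp (z ζ) - ∑ j, (c j : ℂ) * Complex.exp (z ζ * s j)) * (e ζ * h ζ) := by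
          rw [sub_mul, Finset.sum_mul]
          congr 1
          · ring
          · exact Finset.sum_congr rfl fun j _ => by ring
      _ = _ := by
          rw [hrep, ← integral_mul_const]
          refine integral_congr_ae (Filter.Eventually.of_forall fun σ => ?_)
          simp only
          ring
  refine (integral_congr_ae (Filter.Eventually.of_forall e2)).trans ?_
  have hprod : Integrable (Function.uncurry fun (ζ : EuclideanSpace ℝ ι) (σ : ℝ) =>
      (K σ : ℂ) * (e ζ * Complex.exp (z ζ * σ)) * (z ζ ^ (m + 1) * h ζ))
      (volume.prod (volume.restrict (Set.Ioc ε 1))) := by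
    have hb : Integrable (fun q : EuclideanSpace ℝ ι × ℝ => z q.1 ^ (m + 1) * h q.1)
        (volume.prod (volume.restrict (Set.Ioc ε 1))) := by
      refine Integrable.comp_fst (f := fun ζ => z ζ ^ (m + 1) * h ζ) ?_ _
      simp_rw [hzpow, Finset.sum_mul, mul_assoc]
      refine integrable_finsetSum _ fun w _ => ?_
      have := (hw w).const_mul ((∏ i, u (w i) : ℝ) : ℂ)
      simpa only [mul_assoc] using this
    refine hb.bdd_mul (c := κ) ?_ ?_
    · refine AEStronglyMeasurable.mul ?_ ?_
      · exact (Complex.measurable_ofReal.comp (hK.comp measurable_snd)).aestronglyMeasurable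
      · refine Continuous.aestronglyMeasurable ?_
        simp only [he, hz]
        fun_prop
    · have hae : ∀ᵐ q : EuclideanSpace ℝ ι × ℝ ∂(volume.prod (volume.restrict (Set.Ioc ε 1))),
          q.2 ∈ Set.Ioc ε 1 :=
        Measure.quasiMeasurePreserving_snd.ae (ae_restrict_mem measurableSet_Ioc)
      filter_upwards [hae] with q hq
      simp only [he, hz]
      rw [norm_mul, norm_mul, hmb, hmb', Complex.norm_real, mul_one, mul_one]
      exact hKb _ ⟨hq.1.le, hq.2⟩
  rw [integral_integral_swap hprod]
  refine integral_congr_ae (Filter.Eventually.of_forall fun σ => ?_)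
  have hint2 : ∀ w : Fin (m + 1) → ι, Integrable fun ζ => e ζ * Complex.exp (z ζ * σ) *
      ((2 * Real.pi * Complex.I) ^ (m + 1) * ((∏ i, ζ (w i) : ℝ) : ℂ) * h ζ) := by
    intro w
    refine (hw w).bdd_mul (c := 1) ?_ (Filter.Eventually.of_forall fun ζ => ?_)
    · refine Continuous.aestronglyMeasurable ?_
      simp only [he, hz]
      fun_prop
    · simp only [he, hz]
      rw [norm_mul, hmb, hmb', one_mul]
  simp only
  rw [← integral_finsetSum _ fun w _ => (hint2 w).const_mul _, ← integral_const_mul]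
  refine integral_congr_ae (Filter.Eventually.of_forall fun ζ => ?_)
  simp only
  rw [hzpow, Finset.sum_mul, Finset.mul_sum, Finset.mul_sum]
  refine Finset.sum_congr rfl fun w _ => ?_
  ring

lemma lintegral_enorm_sq_eq {α : Type*} [MeasurableSpace α] {μ : Measure α} (f : α → ℂ) :
    ∫⁻ x, ‖f x‖ₑ ^ 2 ∂μ = eLpNorm f 2 μ ^ 2 := by
  have := eLpNorm_nnreal_pow_eq_lintegral (f := f) (μ := μ) (p := 2) (by norm_num)
  simpa using this.symm

lemma eLpNorm_two_le_of_lintegral_sq_le {α β : Type*} [MeasurableSpace α] [MeasurableSpace β]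
    {μ : Measure α} {ν : Measure β} {f : α → ℂ} {g : β → ℂ} {C : ENNReal}
    (h : ∫⁻ x, ‖f x‖ₑ ^ 2 ∂μ ≤ C ^ 2 * ∫⁻ x, ‖g x‖ₑ ^ 2 ∂ν) :
    eLpNorm f 2 μ ≤ C * eLpNorm g 2 ν := by
  rw [lintegral_enorm_sq_eq, lintegral_enorm_sq_eq, ← mul_pow] at h
  exact (ENNReal.pow_le_pow_left_iff two_ne_zero).1 h

lemma sq_lintegral_le_of_measure_le_one {α : Type*} [MeasurableSpace α] {μ : Measure α}
    (hμ : μ Set.univ ≤ 1) {ψ : α → ENNReal} (hψ : AEMeasurable ψ μ) :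
    (∫⁻ x, ψ x ∂μ) ^ 2 ≤ ∫⁻ x, ψ x ^ 2 ∂μ := by
  have h := ENNReal.lintegral_mul_le_Lp_mul_Lq μ Real.HolderConjugate.two_two hψ
    (aemeasurable_const (b := (1 : ENNReal)))
  simp only [Pi.mul_apply, mul_one, ENNReal.rpow_ofNat, one_pow, lintegral_one] at h
  have h2 : (μ Set.univ) ^ (1 / 2 : ℝ) ≤ 1 := ENNReal.rpow_le_one hμ (by norm_num)
  have h3 : ∫⁻ x, ψ x ∂μ ≤ (∫⁻ x, ψ x ^ 2 ∂μ) ^ (1 / 2 : ℝ) :=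
    h.trans (mul_le_of_le_one_right' h2)
  calc _ ≤ ((∫⁻ x, ψ x ^ 2 ∂μ) ^ (1 / 2 : ℝ)) ^ 2 := by gcongr
    _ = _ := by rw [← ENNReal.rpow_natCast, ← ENNReal.rpow_mul]; simp

/-- Expanding (∑ u_i²)^n over words shows that the tensor power of u has norm ‖u‖^n exactly. -/
lemma sum_prod_sq_eq_norm_pow {ι : Type*} [Fintype ι] (u : EuclideanSpace ℝ ι) (n : ℕ) :
    ∑ w : Fin n → ι, (∏ i, u (w i)) ^ 2 = (‖u‖ ^ n) ^ 2 := by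
  rw [← pow_mul, mul_comm, pow_mul, EuclideanSpace.norm_sq_eq, Fintype.sum_pow]
  refine Finset.sum_congr rfl fun w _ => ?_
  rw [← Finset.prod_pow]
  simp

/-- Cauchy–Schwarz over words, so that summing over all words costs no further factor that grows
with their number. -/
lemma enorm_sum_monomial_mul_sq_le {ι : Type*} [Fintype ι] {u : EuclideanSpace ℝ ι} {D : ℝ}
    (hu : ‖u‖ ≤ D) (n : ℕ) (F : (Fin n → ι) → ℂ) :
    ‖∑ w : Fin n → ι, ((∏ i, u (w i) : ℝ) : ℂ) * F w‖ₑ ^ 2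
      ≤ ENNReal.ofReal (D ^ n) ^ 2 * ∑ w, ‖F w‖ₑ ^ 2 := by
  have hD : 0 ≤ D := (norm_nonneg u).trans hu
  have h : ‖∑ w : Fin n → ι, ((∏ i, u (w i) : ℝ) : ℂ) * F w‖ ^ 2 ≤ (D ^ n) ^ 2 * ∑ w, ‖F w‖ ^ 2 := by
    calc _ ≤ (∑ w : Fin n → ι, |∏ i, u (w i)| * ‖F w‖) ^ 2 := by
          gcongr
          refine (norm_sum_le _ _).trans (Finset.sum_le_sum fun w _ => ?_)
          rw [norm_mul, Complex.norm_real, Real.norm_eq_abs]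
      _ ≤ (∑ w : Fin n → ι, |∏ i, u (w i)| ^ 2) * ∑ w, ‖F w‖ ^ 2 :=
          Finset.sum_mul_sq_le_sq_mul_sq _ _ _
      _ ≤ _ := by
          simp_rw [sq_abs]
          rw [sum_prod_sq_eq_norm_pow]
          gcongr
  have e : ∀ z : ℂ, ‖z‖ₑ ^ 2 = ENNReal.ofReal (‖z‖ ^ 2) := fun z => by
    rw [ENNReal.ofReal_pow (norm_nonneg _), ofReal_norm]
  simp_rw [e]
  rw [← ENNReal.ofReal_pow (by positivity), ← ENNReal.ofReal_sum_of_nonneg fun _ _ => by positivity,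
    ← ENNReal.ofReal_mul (by positivity)]
  exact ENNReal.ofReal_le_ofReal h

open FourierTransform in
lemma continuous_fourierInv {V : Type*} [NormedAddCommGroup V] [InnerProductSpace ℝ V]
    [FiniteDimensional ℝ V] [MeasurableSpace V] [BorelSpace V] {h : V → ℂ} (h1 : Integrable h) :
    Continuous (𝓕⁻ h) :=
  VectorFourier.fourierIntegral_continuous Real.continuous_fourierChar
    (by simpa using! continuous_inner.neg) h1

set_option maxHeartbeats 1000000 in
open FourierTransform in
/-- Quantitative unique continuation for functions whose Fourier transform decays exponentially,
with the data left as parameters. -/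
lemma eLpNorm_fourierInv_le {ι : Type*} [Fintype ι] {ω : Set (EuclideanSpace ℝ ι)}
    (hωm : MeasurableSet ω) {D ε : ℝ} (hε : 0 < ε) (hε1 : 2 * ε ≤ 1)
    {β : EuclideanSpace ℝ ι → EuclideanSpace ℝ ι}
    (hβ : Measurable β) (hβD : ∀ x, ‖x - β x‖ ≤ D)
    (hβω : ∀ x, ∀ s : ℝ, 0 ≤ s → s ≤ 2 * ε → β x + s • (x - β x) ∈ ω)
    (hβi : ∀ σ : ℝ, 0 < σ → σ ≤ 1 → ∀ G : EuclideanSpace ℝ ι → ENNReal, Measurable G →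
        ∫⁻ x, G (β x + σ • (x - β x)) ≤ ENNReal.ofReal ((σ ^ Fintype.card ι)⁻¹) * ∫⁻ x, G x)
    {a : ℝ} (ha : 0 < a) {k : EuclideanSpace ℝ ι → ℂ} (hk : MemLp k 2) (m : ℕ)
    {h : EuclideanSpace ℝ ι → ℂ} (hh : h = fun ζ => (Real.exp (-(a * ‖ζ‖)) : ℂ) * k ζ) :
    eLpNorm (𝓕⁻ h) 2 volume ≤
      ENNReal.ofReal ((2 * Real.exp 1 / ε) ^ (m + 1) * Real.sqrt ((ε ^ Fintype.card ι)⁻¹)) *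
          eLpNorm (𝓕⁻ h) 2 (volume.restrict ω) +
      ENNReal.ofReal ((1 + (2 * Real.exp 1 / ε) ^ (m + 1)) * (m + 1) *
          (2 * Real.pi * D / a) ^ (m + 1) * Real.sqrt ((ε ^ Fintype.card ι)⁻¹)) *
          eLpNorm k 2 volume := by
  have hD : 0 ≤ D := (norm_nonneg _).trans (hβD 0)
  obtain ⟨c, s, hs, hcs, hc⟩ := exists_extrapolation_coeff m hε hε1
  obtain ⟨K, hK, hKb, hrep⟩ := exists_peano_kernel m hε hε1 hs hc
  set κ : ℝ := (1 + ∑ j, |c j|) / m ! with hκ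
  have hκ0 : 0 ≤ κ := by positivity
  set n := Fintype.card ι
  set B : ℝ := Real.sqrt ((ε ^ n)⁻¹) with hB
  have hJ : ∀ σ : ℝ, ε ≤ σ → ENNReal.ofReal ((σ ^ n)⁻¹) ≤ ENNReal.ofReal B ^ 2 := by
    intro σ hσ
    rw [← ENNReal.ofReal_pow (Real.sqrt_nonneg _), Real.sq_sqrt (by positivity)]
    apply ENNReal.ofReal_le_ofReal
    gcongr
  have hB0 : 0 ≤ B := Real.sqrt_nonneg _
  clear_value κ B
  have hintj : ∀ j : ℕ, Integrable fun ζ => (‖ζ‖ ^ j : ℝ) * h ζ := by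
    intro j
    have h1 := (memLp_two_norm_pow_mul_exp_neg (volume : Measure (EuclideanSpace ℝ ι)) ha j).ofReal
      (K := ℂ)
    refine (h1.integrable_mul hk).congr (Filter.Eventually.of_forall fun ζ => ?_)
    simp [hh, mul_assoc]
  have h0 : Integrable h := by simpa using hintj 0
  have hFc : Continuous (𝓕⁻ h) := continuous_fourierInv h0
  set hw : (Fin (m + 1) → ι) → EuclideanSpace ℝ ι → ℂ := fun w ζ =>
    (2 * Real.pi * Complex.I) ^ (m + 1) * ((∏ i, ζ (w i) : ℝ) : ℂ) * h ζ with hhw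
  have hsumw : ∀ ζ, ∑ w, ‖hw w ζ‖ ^ 2 = ((2 * Real.pi) ^ (m + 1) * ‖ζ‖ ^ (m + 1) * ‖h ζ‖) ^ 2 := by
    intro ζ
    rw [mul_pow, mul_pow, ← sum_prod_sq_eq_norm_pow, Finset.mul_sum, Finset.sum_mul]
    refine Finset.sum_congr rfl fun w _ => ?_
    simp only [hhw, norm_mul, norm_pow, Complex.norm_real, Complex.norm_I, Real.norm_eq_abs,
      Complex.norm_ofNat, mul_one, abs_of_pos Real.pi_pos]
    rw [mul_pow, mul_pow, sq_abs]
  have hmeasw : ∀ w, AEStronglyMeasurable (hw w) volume := by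
    intro w
    refine AEStronglyMeasurable.mul (Continuous.aestronglyMeasurable ?_) h0.1
    have : Continuous fun ζ : EuclideanSpace ℝ ι => ∏ i, ζ (w i) := by fun_prop
    fun_prop
  have hle : ∀ w ζ, ‖hw w ζ‖ ≤ (2 * Real.pi) ^ (m + 1) * ‖ζ‖ ^ (m + 1) * ‖h ζ‖ := by
    intro w ζ
    refine le_of_sq_le_sq ?_ (by positivity)
    rw [← hsumw]
    exact Finset.single_le_sum (f := fun w => ‖hw w ζ‖ ^ 2) (fun _ _ => by positivity)
      (Finset.mem_univ w)
  -- A bound for the supremum of (2π|ζ|)^(m+1) e^(-a|ζ|).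
  set M : ℝ := (m + 1)! * (2 * Real.pi / a) ^ (m + 1) with hM
  have hhk : ∀ ζ, (2 * Real.pi) ^ (m + 1) * ‖ζ‖ ^ (m + 1) * ‖h ζ‖ ≤ M * ‖k ζ‖ := by
    intro ζ
    have h1 := pow_mul_exp_neg_le ha (norm_nonneg ζ) (m + 1)
    rw [hh, norm_mul, Complex.norm_real, Real.norm_eq_abs, abs_of_pos (Real.exp_pos _)]
    calc _ = (2 * Real.pi) ^ (m + 1) * (‖ζ‖ ^ (m + 1) * Real.exp (-(a * ‖ζ‖))) * ‖k ζ‖ := by ring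
      _ ≤ (2 * Real.pi) ^ (m + 1) * ((m + 1)! / a ^ (m + 1)) * ‖k ζ‖ := by gcongr
      _ = _ := by rw [hM, div_pow]; ring
  have hM0 : 0 ≤ M := by positivity
  clear_value M
  have hw1 : ∀ w, Integrable (hw w) := by
    intro w
    refine ((hintj (m + 1)).norm.const_mul ((2 * Real.pi) ^ (m + 1))).mono' (hmeasw w)
      (Filter.Eventually.of_forall fun ζ => (hle w ζ).trans_eq ?_)
    rw [norm_mul, Complex.norm_real, Real.norm_eq_abs, abs_of_nonneg (by positivity), mul_assoc]
  have hw2 : ∀ w, MemLp (hw w) 2 := by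
    intro w
    exact (hk.norm.const_mul M).mono' (hmeasw w)
      (Filter.Eventually.of_forall fun ζ => (hle w ζ).trans (hhk ζ))
  have hFw : ∀ w, Continuous (𝓕⁻ (hw w)) := fun w => continuous_fourierInv (hw1 w)
  set Φ : ℝ → EuclideanSpace ℝ ι → EuclideanSpace ℝ ι := fun σ x => β x + σ • (x - β x) with hΦ
  set S : EuclideanSpace ℝ ι → ℝ → ℂ := fun x σ =>
    ∑ w : Fin (m + 1) → ι, ((∏ i, (x - β x) (w i) : ℝ) : ℂ) * 𝓕⁻ (hw w) (Φ σ x) with hS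
  set R : EuclideanSpace ℝ ι → ℂ := fun x => ∫ σ in Set.Ioc ε 1, (K σ : ℂ) * S x σ with hR
  have hFR : ∀ x, 𝓕⁻ h x = (∑ j, (c j : ℂ) * 𝓕⁻ h (Φ (s j) x)) + R x := by
    intro x
    have := fourierInv_extrapolation m h0 (hintj (m + 1)) hK hKb hrep (β x) (x - β x)
    rw [add_sub_cancel, sub_eq_iff_eq_add'] at this
    exact this
  have hΦm : Measurable fun q : EuclideanSpace ℝ ι × ℝ => Φ q.2 q.1 := by
    simp only [hΦ]; fun_prop
  have hΦs : ∀ σ, Measurable (Φ σ) := fun σ => by simp only [hΦ]; fun_prop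
  have hSm : Measurable fun q : EuclideanSpace ℝ ι × ℝ => S q.1 q.2 := by
    simp only [hS]
    refine Finset.measurable_sum _ fun w _ => Measurable.mul ?_ ((hFw w).measurable.comp hΦm)
    refine Complex.measurable_ofReal.comp (Finset.measurable_prod _ fun i _ => ?_)
    fun_prop
  -- the remainder
  have hRsq : ∫⁻ x, ‖R x‖ₑ ^ 2 ≤ ENNReal.ofReal (κ * D ^ (m + 1) * B * M) ^ 2 * ∫⁻ ζ, ‖k ζ‖ₑ ^ 2 := by
    have b1 : ∀ x, ‖R x‖ₑ ^ 2 ≤ ENNReal.ofReal κ ^ 2 * (ENNReal.ofReal (D ^ (m + 1)) ^ 2 *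
        ∫⁻ σ in Set.Ioc ε 1, ∑ w, ‖𝓕⁻ (hw w) (Φ σ x)‖ₑ ^ 2) := by
      intro x
      have hSx : Measurable (S x) := Measurable.of_uncurry_left (f := S) hSm
      have e1 : ‖R x‖ₑ ≤ ENNReal.ofReal κ * ∫⁻ σ in Set.Ioc ε 1, ‖S x σ‖ₑ := by
        refine (enorm_integral_le_lintegral_enorm _).trans ?_
        rw [← lintegral_const_mul _ hSx.enorm]
        refine setLIntegral_mono' measurableSet_Ioc fun σ hσ => ?_
        rw [enorm_mul]
        gcongr
        rw [← ofReal_norm, Complex.norm_real]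
        exact ENNReal.ofReal_le_ofReal (hKb σ ⟨hσ.1.le, hσ.2⟩)
      calc _ ≤ (ENNReal.ofReal κ * ∫⁻ σ in Set.Ioc ε 1, ‖S x σ‖ₑ) ^ 2 := by gcongr
        _ = ENNReal.ofReal κ ^ 2 * (∫⁻ σ in Set.Ioc ε 1, ‖S x σ‖ₑ) ^ 2 := mul_pow _ _ _
        _ ≤ ENNReal.ofReal κ ^ 2 * ∫⁻ σ in Set.Ioc ε 1, ‖S x σ‖ₑ ^ 2 := by
            gcongr
            refine sq_lintegral_le_of_measure_le_one ?_ hSx.enorm.aemeasurable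
            rw [Measure.restrict_apply_univ, Real.volume_Ioc, ← ENNReal.ofReal_one]
            exact ENNReal.ofReal_le_ofReal (by linarith)
        _ ≤ _ := by
            gcongr
            rw [← lintegral_const_mul']
            · exact lintegral_mono fun σ => enorm_sum_monomial_mul_sq_le (hβD x) _ _
            · exact ENNReal.pow_ne_top ENNReal.ofReal_ne_top
    have hGm : Measurable fun y => ∑ w, ‖𝓕⁻ (hw w) y‖ₑ ^ 2 :=
      Finset.measurable_sum _ fun w _ => (hFw w).measurable.enorm.pow_const 2
    -- After exchanging the integrals, each contraction by σ ≥ ε costs at most the Jacobian ε^(-n) =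
    -- B².
    have b2 : ∫⁻ x, ∫⁻ σ in Set.Ioc ε 1, ∑ w, ‖𝓕⁻ (hw w) (Φ σ x)‖ₑ ^ 2
        ≤ ENNReal.ofReal B ^ 2 * ∫⁻ y, ∑ w, ‖𝓕⁻ (hw w) y‖ₑ ^ 2 := by
      rw [lintegral_lintegral_swap (f := fun x σ => ∑ w, ‖𝓕⁻ (hw w) (Φ σ x)‖ₑ ^ 2)
        (hGm.comp hΦm).aemeasurable]
      calc _ ≤ ∫⁻ σ in Set.Ioc ε 1, ENNReal.ofReal B ^ 2 * ∫⁻ y, ∑ w, ‖𝓕⁻ (hw w) y‖ₑ ^ 2 := by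
            refine setLIntegral_mono' measurableSet_Ioc fun σ hσ => ?_
            refine (hβi σ (hε.trans hσ.1) hσ.2 _ hGm).trans ?_
            gcongr
            exact hJ σ hσ.1.le
        _ ≤ _ := by
            rw [setLIntegral_const]
            refine mul_le_of_le_one_right' ?_
            rw [Real.volume_Ioc, ← ENNReal.ofReal_one]
            exact ENNReal.ofReal_le_ofReal (by linarith)
    -- Plancherel for each word; on the frequency side the sum over words recombines into |ζ|^(m+1).
    have b3 : ∫⁻ y, ∑ w, ‖𝓕⁻ (hw w) y‖ₑ ^ 2 ≤ ENNReal.ofReal M ^ 2 * ∫⁻ ζ, ‖k ζ‖ₑ ^ 2 := by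
      rw [lintegral_finsetSum _ fun w _ => (hFw w).measurable.enorm.pow_const 2]
      simp_rw [fun w => lintegral_fourierInv_sq (hw1 w) (hw2 w)]
      rw [← lintegral_finsetSum' _ fun w _ => (hmeasw w).enorm.pow_const 2, ← lintegral_const_mul']
      · refine lintegral_mono fun ζ => ?_
        have e : ∀ z : ℂ, ‖z‖ₑ ^ 2 = ENNReal.ofReal (‖z‖ ^ 2) := fun z => by
          rw [ENNReal.ofReal_pow (norm_nonneg _), ofReal_norm]
        simp_rw [e]
        rw [← ENNReal.ofReal_sum_of_nonneg fun _ _ => by positivity,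
          ← ENNReal.ofReal_pow (by positivity), ← ENNReal.ofReal_mul (by positivity), hsumw]
        exact ENNReal.ofReal_le_ofReal
          ((pow_le_pow_left₀ (by positivity) (hhk ζ) 2).trans_eq (mul_pow _ _ _))
      · exact ENNReal.pow_ne_top ENNReal.ofReal_ne_top
    calc _ ≤ ∫⁻ x, ENNReal.ofReal κ ^ 2 * (ENNReal.ofReal (D ^ (m + 1)) ^ 2 *
        ∫⁻ σ in Set.Ioc ε 1, ∑ w, ‖𝓕⁻ (hw w) (Φ σ x)‖ₑ ^ 2) := lintegral_mono b1
      _ = ENNReal.ofReal κ ^ 2 * (ENNReal.ofReal (D ^ (m + 1)) ^ 2 * ∫⁻ x,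
        ∫⁻ σ in Set.Ioc ε 1, ∑ w, ‖𝓕⁻ (hw w) (Φ σ x)‖ₑ ^ 2) := by
          rw [lintegral_const_mul', lintegral_const_mul'] <;>
            exact ENNReal.pow_ne_top ENNReal.ofReal_ne_top
      _ ≤ ENNReal.ofReal κ ^ 2 * (ENNReal.ofReal (D ^ (m + 1)) ^ 2 * (ENNReal.ofReal B ^ 2 *
          (ENNReal.ofReal M ^ 2 * ∫⁻ ζ, ‖k ζ‖ₑ ^ 2))) := by
          gcongr
          exact b2.trans (by gcongr)
      _ = _ := by
          rw [ENNReal.ofReal_mul (by positivity), ENNReal.ofReal_mul (by positivity),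
            ENNReal.ofReal_mul (by positivity)]
          ring
  have hRn := eLpNorm_two_le_of_lintegral_sq_le hRsq
  -- the nodes
  have hnode : ∀ j, eLpNorm (fun x => 𝓕⁻ h (Φ (s j) x)) 2 volume
      ≤ ENNReal.ofReal B * eLpNorm (𝓕⁻ h) 2 (volume.restrict ω) := by
    intro j
    apply eLpNorm_two_le_of_lintegral_sq_le
    have hs0 : 0 < s j := hε.trans_le (hs j).1
    set G : EuclideanSpace ℝ ι → ENNReal := ω.indicator fun y => ‖𝓕⁻ h y‖ₑ ^ 2 with hG
    have hGm : Measurable G := (hFc.measurable.enorm.pow_const 2).indicator hωm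
    calc _ = ∫⁻ x, G (Φ (s j) x) := by
          refine lintegral_congr fun x => ?_
          rw [hG, Set.indicator_of_mem (hβω x (s j) hs0.le (hs j).2)]
      _ ≤ ENNReal.ofReal ((s j ^ n)⁻¹) * ∫⁻ x, G x :=
          hβi (s j) hs0 ((hs j).2.trans hε1) G hGm
      _ ≤ _ := by
          rw [hG, lintegral_indicator hωm]
          gcongr
          exact hJ _ (hs j).1
  have hRm : AEStronglyMeasurable R volume := by
    have : StronglyMeasurable fun q : EuclideanSpace ℝ ι × ℝ => (K q.2 : ℂ) * S q.1 q.2 :=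
      ((Complex.measurable_ofReal.comp (hK.comp measurable_snd)).mul hSm).stronglyMeasurable
    exact (this.integral_prod_right (ν := volume.restrict (Set.Ioc ε 1))).aestronglyMeasurable
  have hnm : ∀ j, AEStronglyMeasurable (fun x => (c j : ℂ) * 𝓕⁻ h (Φ (s j) x)) volume := fun j =>
    ((hFc.measurable.comp (hΦs _)).const_mul _).aestronglyMeasurable
  have hsplit : 𝓕⁻ h = (∑ j, fun x => (c j : ℂ) * 𝓕⁻ h (Φ (s j) x)) + R := by
    ext x
    rw [Pi.add_apply, Finset.sum_apply]
    exact hFR x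
  calc eLpNorm (𝓕⁻ h) 2 volume
      = eLpNorm ((∑ j, fun x => (c j : ℂ) * 𝓕⁻ h (Φ (s j) x)) + R) 2 volume := by rw [← hsplit]
    _ ≤ eLpNorm (∑ j, fun x => (c j : ℂ) * 𝓕⁻ h (Φ (s j) x)) 2 volume + eLpNorm R 2 volume :=
        eLpNorm_add_le (Finset.aestronglyMeasurable_sum _ fun j _ => hnm j) hRm (by norm_num)
    _ ≤ (∑ j, ENNReal.ofReal |c j| * (ENNReal.ofReal B * eLpNorm (𝓕⁻ h) 2 (volume.restrict ω)))
          + ENNReal.ofReal (κ * D ^ (m + 1) * B * M) * eLpNorm k 2 volume := by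
        refine add_le_add ((eLpNorm_sum_le (fun j _ => hnm j) (by norm_num)).trans
          (Finset.sum_le_sum fun j _ => ?_)) hRn
        have := eLpNorm_const_smul (c j : ℂ) (fun x => 𝓕⁻ h (Φ (s j) x)) 2
          (volume : Measure (EuclideanSpace ℝ ι))
        rw [← ofReal_norm, Complex.norm_real, Real.norm_eq_abs] at this
        refine (le_of_eq this).trans ?_
        gcongr
        exact hnode j
    _ ≤ _ := by
        rw [← Finset.sum_mul, ← ENNReal.ofReal_sum_of_nonneg fun _ _ => abs_nonneg _, ← mul_assoc,
          ← ENNReal.ofReal_mul (by positivity)]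
        refine add_le_add (by gcongr) ?_
        gcongr ENNReal.ofReal ?_ * _
        -- The 1/m! of the Peano kernel cancels the (m+1)! of M up to a factor m + 1.
        rw [hM, hκ, Nat.factorial_succ]
        have : (1 + ∑ j, |c j|) / (m ! : ℝ) * D ^ (m + 1) * B *
            (((m + 1) * m ! : ℕ) * (2 * Real.pi / a) ^ (m + 1))
            = (1 + ∑ j, |c j|) * (m + 1) * (2 * Real.pi * D / a) ^ (m + 1) * B := by
          push_cast
          rw [show 2 * Real.pi * D / a = 2 * Real.pi / a * D by ring, mul_pow (2 * Real.pi / a)]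
          field_simp
        rw [this]
        gcongr

open FourierTransform in
/-- Quantitative unique continuation from an observability open set, for functions whose Fourier
transform decays exponentially. -/
theorem IsObservabilityOpenSet.exists_norm_le_of_fourier_decay {ι : Type*} [Fintype ι]
    {ω : Set (EuclideanSpace ℝ ι)} (hω : IsObservabilityOpenSet ω) :
    ∃ A : ℝ, 1 ≤ A ∧ ∃ a : ℝ, 0 < a ∧ ∀ f k : Lp ℂ 2 (volume : Measure (EuclideanSpace ℝ ι)),
      (𝓕 f : Lp ℂ 2 (volume : Measure (EuclideanSpace ℝ ι)))
        =ᵐ[volume] (fun ζ => (Real.exp (-(a * ‖ζ‖)) : ℂ) * k ζ) →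
      ∀ m : ℕ, ‖f‖ ≤ A ^ (m + 1) * (eLpNorm f 2 (volume.restrict ω)).toReal
        + (1 / 2) ^ (m + 1) * ‖k‖ := by
  obtain ⟨D, hD, ε, hε, hε1, β, hβ, hβD, hβω, hβi⟩ := hω.exists_centres
  set C : ℝ := 2 * Real.exp 1 / ε with hC
  set B : ℝ := Real.sqrt ((ε ^ Fintype.card ι)⁻¹) with hB
  have hB1 : 1 ≤ B := by
    rw [hB, Real.one_le_sqrt]
    exact (one_le_inv₀ (by positivity)).2 (pow_le_one₀ hε.le (by linarith))
  have hC1 : 1 ≤ C := by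
    rw [hC, le_div_iff₀ hε]
    linarith [Real.add_one_le_exp 1]
  have hB0 : 0 < B := by linarith
  have hC0 : 0 < C := by linarith
  clear_value B C
  have ha : 0 < 8 * Real.pi * D * C * B := by positivity
  -- With 1 ≤ C^(m+1), B ≤ B^(m+1) and 2(m+1) ≤ 2^(m+1), the remainder is at most (C · 2 · (2πD/a) ·
  -- B)^(m+1); this a makes the base equal to 1/2.
  refine ⟨C * B, one_le_mul_of_one_le_of_one_le hC1 hB1, 8 * Real.pi * D * C * B, ha, ?_⟩
  intro f k hfk m
  set a := 8 * Real.pi * D * C * B with ha'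
  set h : EuclideanSpace ℝ ι → ℂ := fun ζ => (Real.exp (-(a * ‖ζ‖)) : ℂ) * k ζ with hh
  have key := eLpNorm_fourierInv_le hω.1.measurableSet hε hε1 hβ hβD hβω hβi ha (Lp.memLp k) m hh
  rw [← hC, ← hB] at key
  have h0 : Integrable h := by
    have h1 := (memLp_two_norm_pow_mul_exp_neg (volume : Measure (EuclideanSpace ℝ ι)) ha 0).ofReal
      (K := ℂ)
    refine (h1.integrable_mul (Lp.memLp k)).congr (Filter.Eventually.of_forall fun ζ => ?_)
    simp [hh]
  have hf := ae_eq_fourierInv_of_fourier_ae_eq f h0 hfk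
  rw [← eLpNorm_congr_ae hf, ← eLpNorm_congr_ae (ae_restrict_of_ae hf)] at key
  have hfω : eLpNorm f 2 (volume.restrict ω) ≠ ⊤ :=
    ((Lp.memLp f).restrict ω).eLpNorm_lt_top.ne
  have hk : eLpNorm k 2 volume ≠ ⊤ := (Lp.memLp k).eLpNorm_lt_top.ne
  have key2 := ENNReal.toReal_mono (ENNReal.add_ne_top.2
    ⟨ENNReal.mul_ne_top ENNReal.ofReal_ne_top hfω, ENNReal.mul_ne_top ENNReal.ofReal_ne_top hk⟩) key
  rw [ENNReal.toReal_add (ENNReal.mul_ne_top ENNReal.ofReal_ne_top hfω)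
    (ENNReal.mul_ne_top ENNReal.ofReal_ne_top hk), ENNReal.toReal_mul, ENNReal.toReal_mul,
    ENNReal.toReal_ofReal (by positivity), ENNReal.toReal_ofReal (by positivity),
    ← Lp.norm_def, ← Lp.norm_def] at key2
  have hBm : B ≤ B ^ (m + 1) := le_self_pow₀ hB1 (Nat.succ_ne_zero m)
  have hCm : 1 ≤ C ^ (m + 1) := one_le_pow₀ hC1
  have h2m : 2 * ((m : ℝ) + 1) ≤ 2 ^ (m + 1) := by
    rw [pow_succ, mul_comm]
    gcongr
    exact_mod_cast Nat.lt_two_pow_self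
  refine key2.trans (add_le_add ?_ ?_)
  · rw [mul_pow]
    gcongr
  · gcongr
    calc (1 + C ^ (m + 1)) * ((m : ℝ) + 1) * (2 * Real.pi * D / a) ^ (m + 1) * B
        ≤ (C ^ (m + 1) + C ^ (m + 1)) * ((m : ℝ) + 1) * (2 * Real.pi * D / a) ^ (m + 1)
            * B ^ (m + 1) := by gcongr
      _ = C ^ (m + 1) * (2 * ((m : ℝ) + 1)) * (2 * Real.pi * D / a) ^ (m + 1) * B ^ (m + 1) := by
          ring
      _ ≤ C ^ (m + 1) * 2 ^ (m + 1) * (2 * Real.pi * D / a) ^ (m + 1) * B ^ (m + 1) := by gcongr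
      _ = (C * 2 * (2 * Real.pi * D / a) * B) ^ (m + 1) := by simp only [mul_pow]
      _ = _ := by
          congr 1
          rw [ha']
          have := Real.pi_pos
          field_simp
          norm_num

/-! ### Pairing L² curves with fixed functions. -/

lemma norm_integral_Lp_mul_le {α : Type*} [MeasurableSpace α] {μ : Measure α} (f : Lp ℂ 2 μ)
    {w : α → ℂ} (hw : MemLp w 2 μ) :
    ‖∫ z, f z * w z ∂μ‖ ≤ ‖f‖ * (eLpNorm w 2 μ).toReal := by
  have h2 : ∫ z, f z * w z ∂μ = inner ℂ (hw.star.toLp (star w)) f := by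
    rw [L2.inner_def]
    refine integral_congr_ae ?_
    filter_upwards [hw.star.coeFn_toLp] with z hz
    rw [hz]
    simp
  rw [h2]
  refine (norm_inner_le_norm _ _).trans ?_
  rw [mul_comm, Lp.norm_toLp, eLpNorm_star]

lemma integral_Lp_sub_mul {α : Type*} [MeasurableSpace α] {μ : Measure α} (f g : Lp ℂ 2 μ)
    {w : α → ℂ} (hw : MemLp w 2 μ) :
    ∫ z, (f - g) z * w z ∂μ = (∫ z, f z * w z ∂μ) - ∫ z, g z * w z ∂μ := by
  have hi : ∀ f : Lp ℂ 2 μ, Integrable (fun z => f z * w z) μ := fun f =>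
    (Lp.memLp f).integrable_mul hw
  rw [← integral_sub (hi f) (hi g)]
  refine integral_congr_ae ?_
  filter_upwards [Lp.coeFn_sub f g] with z hz
  rw [hz, Pi.sub_apply]
  simp [sub_mul]

lemma continuousOn_integral_Lp_mul {α : Type*} [MeasurableSpace α] {μ : Measure α}
    {g : ℝ → Lp ℂ 2 μ} {S : Set ℝ} (hg : ContinuousOn g S) {w : α → ℂ} (hw : MemLp w 2 μ) :
    ContinuousOn (fun s => ∫ z, g s z * w z ∂μ) S := by
  intro s hs
  have h := hg s hs
  unfold ContinuousWithinAt at h ⊢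
  rw [tendsto_iff_norm_sub_tendsto_zero] at h ⊢
  refine squeeze_zero (fun _ => norm_nonneg _) (fun t => ?_)
    (by simpa using h.mul_const (eLpNorm w 2 μ).toReal)
  rw [← integral_Lp_sub_mul _ _ hw]
  exact norm_integral_Lp_mul_le _ hw

/-! ### Partial derivatives and coordinate multiplications. -/

section PartialDeriv

variable {ι : Type*} [Fintype ι] [DecidableEq ι]

lemma partialDeriv_mul (i : ι) {f g : EuclideanSpace ℝ ι → ℂ} (hf : Differentiable ℝ f)
    (hg : Differentiable ℝ g) :
    partialDeriv i (fun z => f z * g z)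
      = fun z => f z * partialDeriv i g z + partialDeriv i f z * g z := by
  ext z
  simp only [partialDeriv]
  rw [fderiv_fun_mul (hf z) (hg z)]
  simp [mul_comm]

lemma partialDeriv_add (i : ι) {f g : EuclideanSpace ℝ ι → ℂ} (hf : Differentiable ℝ f)
    (hg : Differentiable ℝ g) :
    partialDeriv i (fun z => f z + g z) = fun z => partialDeriv i f z + partialDeriv i g z := by
  ext z
  simp only [partialDeriv]
  rw [fderiv_fun_add (hf z) (hg z)]
  simp

lemma ContDiff.partialDeriv (i : ι) {f : EuclideanSpace ℝ ι → ℂ}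
    (hf : ContDiff ℝ ((⊤ : ℕ∞) : WithTop ℕ∞) f) :
    ContDiff ℝ ((⊤ : ℕ∞) : WithTop ℕ∞) (partialDeriv i f) := by
  have := hf.fderiv_right (m := ((⊤ : ℕ∞) : WithTop ℕ∞)) (by simp)
  exact this.clm_apply contDiff_const

lemma HasCompactSupport.partialDeriv (i : ι) {f : EuclideanSpace ℝ ι → ℂ}
    (hf : HasCompactSupport f) : HasCompactSupport (partialDeriv i f) :=
  hf.fderiv_apply ℝ _

lemma partialDeriv_comp_smul (i : ι) (f : EuclideanSpace ℝ ι → ℂ) (c : ℝ) :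
    partialDeriv i (fun z => f (c • z)) = fun z => (c : ℂ) * partialDeriv i f (c • z) := by
  ext z
  simp only [partialDeriv]
  rw [fderiv_comp_smul]
  simp

lemma Filter.EventuallyEq.partialDeriv (i : ι) {f g : EuclideanSpace ℝ ι → ℂ}
    {z : EuclideanSpace ℝ ι} (h : f =ᶠ[nhds z] g) :
    partialDeriv i f =ᶠ[nhds z] partialDeriv i g := by
  filter_upwards [h.fderiv (𝕜 := ℝ)] with y hy
  simp only [_root_.partialDeriv, hy]

open LineDeriv SchwartzMap in
/-- The partial derivative of a Schwartz function. -/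
def coordDeriv (i : ι) (f : 𝓢(EuclideanSpace ℝ ι, ℂ)) : 𝓢(EuclideanSpace ℝ ι, ℂ) :=
  ∂_{(EuclideanSpace.single i (1 : ℝ))} f

open LineDeriv SchwartzMap in
lemma partialDeriv_schwartz (i : ι) (f : 𝓢(EuclideanSpace ℝ ι, ℂ)) :
    partialDeriv i f = coordDeriv i f := by
  ext z
  rw [coordDeriv, lineDerivOp_apply_eq_fderiv]
  rfl

open SchwartzMap in
/-- Multiplication of a Schwartz function by a coordinate. -/
def coordMul (i : ι) (f : 𝓢(EuclideanSpace ℝ ι, ℂ)) : 𝓢(EuclideanSpace ℝ ι, ℂ) :=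
  smulLeftCLM ℂ (inner ℝ · (EuclideanSpace.single i (1 : ℝ))) f

open SchwartzMap in
lemma coordMul_apply (i : ι) (f : 𝓢(EuclideanSpace ℝ ι, ℂ)) (z : EuclideanSpace ℝ ι) :
    coordMul i f z = (z i : ℂ) * f z := by
  have : (inner ℝ · (EuclideanSpace.single i (1 : ℝ)) :
      EuclideanSpace ℝ ι → ℝ).HasTemperateGrowth := by fun_prop
  rw [coordMul, smulLeftCLM_apply_apply this, EuclideanSpace.inner_single_right]
  simp

end PartialDeriv

/-! ### The weak formulation against Schwartz functions. -/

section Cutoff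

open LineDeriv SchwartzMap

variable {d : ℕ}

lemma kolmogorovAdjoint_congr {f g : PhaseSpace d → ℂ} {z : PhaseSpace d} (h : f =ᶠ[nhds z] g) :
    kolmogorovAdjoint f z = kolmogorovAdjoint g z := by
  simp only [kolmogorovAdjoint]
  congr 1
  · exact Finset.sum_congr rfl fun i _ => by rw [(h.partialDeriv (Sum.inl i)).eq_of_nhds]
  · exact Finset.sum_congr rfl fun i _ =>
      ((h.partialDeriv (Sum.inr i)).partialDeriv (Sum.inr i)).eq_of_nhds

lemma kolmogorovAdjoint_mul {f g : PhaseSpace d → ℂ}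
    (hf : ContDiff ℝ ((⊤ : ℕ∞) : WithTop ℕ∞) f) (hg : ContDiff ℝ ((⊤ : ℕ∞) : WithTop ℕ∞) g)
    (z : PhaseSpace d) :
    kolmogorovAdjoint (fun z => f z * g z) z
      = (∑ i : Fin d, (z (Sum.inr i) : ℂ) * (f z * partialDeriv (Sum.inl i) g z
          + partialDeriv (Sum.inl i) f z * g z))
        + ∑ i : Fin d, (f z * partialDeriv (Sum.inr i) (partialDeriv (Sum.inr i) g) z
          + partialDeriv (Sum.inr i) f z * partialDeriv (Sum.inr i) g z
          + (partialDeriv (Sum.inr i) f z * partialDeriv (Sum.inr i) g z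
            + partialDeriv (Sum.inr i) (partialDeriv (Sum.inr i) f) z * g z)) := by
  have df : Differentiable ℝ f := hf.differentiable (by simp)
  have dg : Differentiable ℝ g := hg.differentiable (by simp)
  have df' : ∀ i, Differentiable ℝ (partialDeriv i f) := fun i =>
    (hf.partialDeriv i).differentiable (by simp)
  have dg' : ∀ i, Differentiable ℝ (partialDeriv i g) := fun i =>
    (hg.partialDeriv i).differentiable (by simp)
  simp only [kolmogorovAdjoint]
  congr 1
  · refine Finset.sum_congr rfl fun i _ => ?_
    rw [partialDeriv_mul _ df dg]
  · refine Finset.sum_congr rfl fun i _ => ?_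
    rw [partialDeriv_mul _ df dg, partialDeriv_add _ (df.fun_mul (dg' _)) ((df' _).fun_mul dg),
      partialDeriv_mul _ df (dg' _), partialDeriv_mul _ (df' _) dg]

lemma exists_bound_of_hasCompactSupport {V : Type*} [TopologicalSpace V] {f : V → ℂ}
    (hc : Continuous f) (hs : HasCompactSupport f) : ∃ C : ℝ, 0 ≤ C ∧ ∀ z, ‖f z‖ ≤ C := by
  obtain ⟨C, hC⟩ := hs.exists_bound_of_continuous hc
  exact ⟨max C 0, le_max_right _ _, fun z => (hC z).trans (le_max_left _ _)⟩

/-- Approximation of a Schwartz function by test functions, with domination of the images under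
the adjoint Kolmogorov operator. -/
lemma exists_testFunction_approx (ψ : 𝓢(PhaseSpace d, ℂ)) :
    ∃ (η : ℕ → PhaseSpace d → ℂ) (G : PhaseSpace d → ℝ),
      (∀ n, ContDiff ℝ ((⊤ : ℕ∞) : WithTop ℕ∞) (η n)) ∧ (∀ n, HasCompactSupport (η n)) ∧
      MemLp G 2 ∧ (∀ n z, ‖η n z‖ ≤ ‖ψ z‖) ∧ (∀ n z, ‖kolmogorovAdjoint (η n) z‖ ≤ G z) ∧
      (∀ z, ∀ᶠ n in Filter.atTop, η n z = ψ z) ∧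
      (∀ z, ∀ᶠ n in Filter.atTop, kolmogorovAdjoint (η n) z = kolmogorovAdjoint ψ z) := by
  let b : ContDiffBump (0 : PhaseSpace d) := ⟨1, 2, one_pos, one_lt_two⟩
  set χ : PhaseSpace d → ℂ := fun z => (b z : ℂ) with hχ
  have hχc : ContDiff ℝ ((⊤ : ℕ∞) : WithTop ℕ∞) χ := Complex.ofRealCLM.contDiff.comp b.contDiff
  have hχs : HasCompactSupport χ := b.hasCompactSupport.comp_left (g := Complex.ofReal) rfl
  have hχ1 : ∀ z, ‖χ z‖ ≤ 1 := by
    intro z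
    rw [hχ, Complex.norm_real, Real.norm_eq_abs, abs_of_nonneg b.nonneg]
    exact b.le_one
  choose C1 hC1 hC1b using fun i => exists_bound_of_hasCompactSupport
    (hχc.partialDeriv i).continuous (hχs.partialDeriv i)
  choose C2 hC2 hC2b using fun i => exists_bound_of_hasCompactSupport
    ((hχc.partialDeriv i).partialDeriv i).continuous ((hχs.partialDeriv i).partialDeriv i)
  set c : ℕ → ℝ := fun n => ((n : ℝ) + 1)⁻¹ with hc
  have hc0 : ∀ n, 0 < c n := fun n => by positivity
  have hc1 : ∀ n, c n ≤ 1 := fun n => inv_le_one_of_one_le₀ (by simp)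
  set X : ℕ → PhaseSpace d → ℂ := fun n z => χ (c n • z) with hX
  have hXc : ∀ n, ContDiff ℝ ((⊤ : ℕ∞) : WithTop ℕ∞) (X n) := fun n =>
    hχc.comp (contDiff_const_smul _)
  have hXs : ∀ n, HasCompactSupport (X n) := fun n =>
    hχs.comp_homeomorph (Homeomorph.smulOfNeZero (c n) (hc0 n).ne')
  have hnc : ∀ n, ‖(c n : ℂ)‖ ≤ 1 := by
    intro n
    rw [Complex.norm_real, Real.norm_eq_abs, abs_of_pos (hc0 n)]
    exact hc1 n
  have hX1 : ∀ n i z, ‖partialDeriv i (X n) z‖ ≤ C1 i := by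
    intro n i z
    rw [hX, partialDeriv_comp_smul, norm_mul]
    exact (mul_le_of_le_one_left (norm_nonneg _) (hnc n)).trans (hC1b i _)
  have hX2 : ∀ n i z, ‖partialDeriv i (partialDeriv i (X n)) z‖ ≤ C2 i := by
    intro n i z
    have : partialDeriv i (X n) = fun z => (c n : ℂ) * partialDeriv i χ (c n • z) := by
      rw [hX, partialDeriv_comp_smul]
    have hd : Differentiable ℝ fun z : PhaseSpace d => partialDeriv i χ (c n • z) :=
      ((hχc.partialDeriv i).comp (contDiff_const_smul _)).differentiable (by simp)
    rw [this, partialDeriv_mul _ (differentiable_const _) hd, partialDeriv_comp_smul]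
    have hz : ∀ z, partialDeriv i (fun _ : EuclideanSpace ℝ (Fin d ⊕ Fin d) => (c n : ℂ)) z = 0 := by
      simp [partialDeriv]
    simp only [hz, zero_mul, add_zero, norm_mul]
    exact (mul_le_of_le_one_left (by positivity) (hnc n)).trans
      ((mul_le_of_le_one_left (norm_nonneg _) (hnc n)).trans (hC2b i _))
  have hψc : ContDiff ℝ ((⊤ : ℕ∞) : WithTop ℕ∞) (ψ : PhaseSpace d → ℂ) := ψ.smooth ⊤
  -- The dilated cutoffs have derivatives bounded uniformly in n since c n ≤ 1. The unbounded
  -- coefficient v is always absorbed by ψ or its derivatives, which decay rapidly; this gives a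
  -- majorant independent of n.
  refine ⟨fun n z => X n z * ψ z,
    fun z => (∑ i : Fin d, (‖coordMul (Sum.inr i) (coordDeriv (Sum.inl i) ψ) z‖
        + C1 (Sum.inl i) * ‖coordMul (Sum.inr i) ψ z‖))
      + ∑ i : Fin d, (‖(coordDeriv (Sum.inr i)
            (coordDeriv (Sum.inr i) ψ)) z‖
        + C1 (Sum.inr i) * ‖(coordDeriv (Sum.inr i) ψ) z‖
        + (C1 (Sum.inr i) * ‖(coordDeriv (Sum.inr i) ψ) z‖
          + C2 (Sum.inr i) * ‖ψ z‖)), ?_, ?_, ?_, ?_, ?_, ?_, ?_⟩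
  · exact fun n => (hXc n).mul hψc
  · exact fun n => (hXs n).mul_right
  · have hm : ∀ f : 𝓢(PhaseSpace d, ℂ), MemLp (fun z => ‖f z‖) 2 volume := fun f =>
      (f.memLp 2).norm
    refine MemLp.add (memLp_finsetSum _ fun i _ => ?_) (memLp_finsetSum _ fun i _ => ?_)
    · exact (hm _).add ((hm _).const_mul _)
    · exact ((hm _).add ((hm _).const_mul _)).add (((hm _).const_mul _).add ((hm _).const_mul _))
  · intro n z
    rw [norm_mul]
    exact mul_le_of_le_one_left (norm_nonneg _) (hχ1 _)
  · intro n z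
    rw [kolmogorovAdjoint_mul (hXc n) hψc]
    have hXn : ‖X n z‖ ≤ 1 := hχ1 _
    refine (norm_add_le _ _).trans (add_le_add ?_ ?_)
    · refine (norm_sum_le _ _).trans (Finset.sum_le_sum fun i _ => ?_)
      rw [mul_add, coordMul_apply, coordMul_apply, partialDeriv_schwartz]
      refine (norm_add_le _ _).trans (add_le_add ?_ ?_)
      · simp only [norm_mul]
        rw [mul_left_comm]
        exact mul_le_of_le_one_left (by positivity) hXn
      · simp only [norm_mul]
        rw [mul_left_comm]
        exact mul_le_mul_of_nonneg_right (hX1 n _ z) (by positivity)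
    · refine (norm_sum_le _ _).trans (Finset.sum_le_sum fun i _ => ?_)
      rw [partialDeriv_schwartz, partialDeriv_schwartz]
      refine (norm_add_le _ _).trans (add_le_add ((norm_add_le _ _).trans (add_le_add ?_ ?_))
        ((norm_add_le _ _).trans (add_le_add ?_ ?_))) <;> rw [norm_mul]
      · exact mul_le_of_le_one_left (norm_nonneg _) hXn
      · exact mul_le_mul_of_nonneg_right (hX1 n _ z) (norm_nonneg _)
      · exact mul_le_mul_of_nonneg_right (hX1 n _ z) (norm_nonneg _)
      · exact mul_le_mul_of_nonneg_right (hX2 n _ z) (norm_nonneg _)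
  all_goals
    intro z
    obtain ⟨N, hN⟩ := exists_nat_gt ‖z‖
    filter_upwards [Filter.eventually_ge_atTop N] with n hn
    have hev : (fun z => X n z * ψ z) =ᶠ[nhds z] ψ := by
      have hz : c n • z ∈ Metric.ball (0 : PhaseSpace d) b.rIn := by
        rw [mem_ball_zero_iff, norm_smul, Real.norm_eq_abs, abs_of_pos (hc0 n)]
        have : ‖z‖ < (n : ℝ) + 1 := by
          have : (N : ℝ) ≤ n := by exact_mod_cast hn
          linarith
        change ((n : ℝ) + 1)⁻¹ * ‖z‖ < 1
        rw [inv_mul_lt_iff₀ (by positivity)]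
        linarith
      have h1 := b.eventuallyEq_one_of_mem_ball hz
      have h2 : Filter.Tendsto (fun y : PhaseSpace d => c n • y) (nhds z) (nhds (c n • z)) :=
        (continuous_const_smul (c n)).tendsto z
      filter_upwards [h2.eventually h1] with y hy
      simp only [hX, hχ, hy, Pi.one_apply, Complex.ofReal_one, one_mul]
  · exact hev.eq_of_nhds
  · exact kolmogorovAdjoint_congr hev

lemma memLp_kolmogorovAdjoint (ψ : 𝓢(PhaseSpace d, ℂ)) : MemLp (kolmogorovAdjoint ψ) 2 := by
  have h : kolmogorovAdjoint ψ = fun z =>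
      (∑ i : Fin d, coordMul (Sum.inr i) (coordDeriv (Sum.inl i) ψ) z)
      + ∑ i : Fin d, (coordDeriv (Sum.inr i)
            (coordDeriv (Sum.inr i) ψ)) z := by
    ext z
    simp only [kolmogorovAdjoint, partialDeriv_schwartz, coordMul_apply]
  rw [h]
  exact MemLp.add
    (memLp_finsetSum _ fun i _ => (coordMul (Sum.inr i) (coordDeriv (Sum.inl i) ψ)).memLp 2)
    (memLp_finsetSum _ fun i _ => (coordDeriv (Sum.inr i) (coordDeriv (Sum.inr i) ψ)).memLp 2)

/-- The weak formulation extends to Schwartz functions. -/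
lemma IsKolmogorovSolution.weak_schwartz {g₀ : PhaseL2 d} {g : ℝ → PhaseL2 d}
    (h : IsKolmogorovSolution g₀ g) (ψ : 𝓢(PhaseSpace d, ℂ)) {t : ℝ} (ht : 0 ≤ t) :
    ∫ z, g t z * ψ z = (∫ z, g₀ z * ψ z)
      + ∫ s in (0 : ℝ)..t, ∫ z, g s z * kolmogorovAdjoint ψ z := by
  obtain ⟨η, G, hηc, hηs, hG, hηψ, hAG, hlim, hAlim⟩ := exists_testFunction_approx ψ
  have hψ : MemLp (fun z => ‖ψ z‖) 2 volume := (ψ.memLp 2).norm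
  have hAc : ∀ n, Continuous (kolmogorovAdjoint (η n)) := by
    intro n
    have h1 := fun i => ((hηc n).partialDeriv i).continuous
    have h2 := fun i => (((hηc n).partialDeriv i).partialDeriv i).continuous
    unfold kolmogorovAdjoint
    fun_prop
  have hAm : ∀ n, MemLp (kolmogorovAdjoint (η n)) 2 volume := fun n =>
    hG.mono' (hAc n).aestronglyMeasurable (Filter.Eventually.of_forall (hAG n))
  have l1 : ∀ f : PhaseL2 d, Filter.Tendsto (fun n => ∫ z, f z * η n z) Filter.atTop
      (nhds (∫ z, f z * ψ z)) := by
    intro f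
    refine tendsto_integral_of_dominated_convergence (fun z => ‖f z‖ * ‖ψ z‖) (fun n => ?_) ?_
      (fun n => Filter.Eventually.of_forall fun z => ?_) (Filter.Eventually.of_forall fun z => ?_)
    · exact (Lp.aestronglyMeasurable f).mul (hηc n).continuous.aestronglyMeasurable
    · exact (Lp.memLp f).norm.integrable_mul hψ
    · rw [norm_mul]
      exact mul_le_mul_of_nonneg_left (hηψ n z) (norm_nonneg _)
    · exact tendsto_const_nhds.congr' ((hlim z).mono fun n hn => by simp only [hn])
  have l2 : ∀ f : PhaseL2 d, Filter.Tendsto (fun n => ∫ z, f z * kolmogorovAdjoint (η n) z)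
      Filter.atTop (nhds (∫ z, f z * kolmogorovAdjoint ψ z)) := by
    intro f
    refine tendsto_integral_of_dominated_convergence (fun z => ‖f z‖ * G z) (fun n => ?_) ?_
      (fun n => Filter.Eventually.of_forall fun z => ?_) (Filter.Eventually.of_forall fun z => ?_)
    · exact (Lp.aestronglyMeasurable f).mul (hAc n).aestronglyMeasurable
    · exact (Lp.memLp f).norm.integrable_mul hG
    · rw [norm_mul]
      exact mul_le_mul_of_nonneg_left (hAG n z) (norm_nonneg _)
    · exact tendsto_const_nhds.congr' ((hAlim z).mono fun n hn => by simp only [hn])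
  have hsub : Set.uIcc 0 t ⊆ Set.Ici 0 := by
    rw [Set.uIcc_of_le ht]; exact Set.Icc_subset_Ici_self
  have hgt : ContinuousOn g (Set.uIcc 0 t) := h.continuousOn.mono hsub
  have l3 : Filter.Tendsto (fun n => ∫ s in (0 : ℝ)..t, ∫ z, g s z * kolmogorovAdjoint (η n) z)
      Filter.atTop (nhds (∫ s in (0 : ℝ)..t, ∫ z, g s z * kolmogorovAdjoint ψ z)) := by
    refine intervalIntegral.tendsto_integral_filter_of_dominated_convergence
      (fun s => ‖g s‖ * (eLpNorm G 2 volume).toReal) (Filter.Eventually.of_forall fun n => ?_)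
      (Filter.Eventually.of_forall fun n => Filter.Eventually.of_forall fun s _ => ?_) ?_
      (Filter.Eventually.of_forall fun s _ => l2 (g s))
    · have := continuousOn_integral_Lp_mul hgt (hAm n)
      exact (this.mono Set.uIoc_subset_uIcc).aestronglyMeasurable measurableSet_uIoc
    · refine (norm_integral_Lp_mul_le _ (hAm n)).trans ?_
      gcongr
      · exact hG.eLpNorm_lt_top.ne
      · exact eLpNorm_mono_real (hAG n)
    · exact (hgt.norm.mul continuousOn_const).intervalIntegrable
  refine tendsto_nhds_unique (l1 (g t)) ?_
  refine ((l1 g₀).add l3).congr fun n => ?_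
  exact (h.weak (η n) (hηc n) (hηs n) t ht).symm

end Cutoff

/-! ### The equation in frequency. -/

section FourierSide

open LineDeriv SchwartzMap FourierTransform

variable {d : ℕ}

/-- The nilpotent map `(ξ, η) ↦ (0, ξ)` generating the shear flow in frequency. -/
def shearGen (d : ℕ) : PhaseSpace d →L[ℝ] PhaseSpace d :=
  LinearMap.toContinuousLinearMap
    { toFun := fun ζ => WithLp.toLp 2 (Sum.elim (fun _ => 0) fun i => ζ (Sum.inl i))
      map_add' := fun ζ ζ' => by ext (i | i) <;> simp
      map_smul' := fun c ζ => by ext (i | i) <;> simp }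

@[simp] lemma shearGen_inl (ζ : PhaseSpace d) (i : Fin d) : shearGen d ζ (Sum.inl i) = 0 := rfl

@[simp] lemma shearGen_inr (ζ : PhaseSpace d) (i : Fin d) :
    shearGen d ζ (Sum.inr i) = ζ (Sum.inl i) := rfl

@[simp] lemma shearGen_shearGen (ζ : PhaseSpace d) : shearGen d (shearGen d ζ) = 0 := by
  ext (i | i) <;> simp

lemma shearGen_eq_sum (ζ : PhaseSpace d) :
    shearGen d ζ = ∑ i : Fin d, ζ (Sum.inl i) • EuclideanSpace.single (Sum.inr i) (1 : ℝ) := by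
  ext (j | j)
  · simp
  · simp [Pi.single_apply]

/-- The quantity `|η|²` at the frequency `(ξ, η)`. -/
def velSq (ζ : PhaseSpace d) : ℝ := ∑ i : Fin d, ζ (Sum.inr i) ^ 2

/-- The quantity `ξ · η` at the frequency `(ξ, η)`. -/
def posVel (ζ : PhaseSpace d) : ℝ := ∑ i : Fin d, ζ (Sum.inl i) * ζ (Sum.inr i)

/-- The quantity `|ξ|²` at the frequency `(ξ, η)`. -/
def posSq (ζ : PhaseSpace d) : ℝ := ∑ i : Fin d, ζ (Sum.inl i) ^ 2

@[fun_prop] lemma contDiff_velSq {n : WithTop ℕ∞} : ContDiff ℝ n (velSq (d := d)) := by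
  unfold velSq; fun_prop

@[fun_prop] lemma contDiff_posVel {n : WithTop ℕ∞} : ContDiff ℝ n (posVel (d := d)) := by
  unfold posVel; fun_prop

@[fun_prop] lemma contDiff_posSq {n : WithTop ℕ∞} : ContDiff ℝ n (posSq (d := d)) := by
  unfold posSq; fun_prop

lemma velSq_add_smul_shearGen (ζ : PhaseSpace d) (r : ℝ) :
    velSq (ζ + r • shearGen d ζ) = velSq ζ + 2 * r * posVel ζ + r ^ 2 * posSq ζ := by
  simp only [velSq, posVel, posSq, Finset.mul_sum, ← Finset.sum_add_distrib]
  exact Finset.sum_congr rfl fun i _ => by simp; ring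

lemma posVel_add_smul_shearGen (ζ : PhaseSpace d) (r : ℝ) :
    posVel (ζ + r • shearGen d ζ) = posVel ζ + r * posSq ζ := by
  simp only [posVel, posSq, Finset.mul_sum, ← Finset.sum_add_distrib]
  exact Finset.sum_congr rfl fun i _ => by simp; ring

lemma posSq_add_smul_shearGen (ζ : PhaseSpace d) (r : ℝ) :
    posSq (ζ + r • shearGen d ζ) = posSq ζ := by
  simp only [posSq]
  exact Finset.sum_congr rfl fun i _ => by simp

/-- The adjoint Kolmogorov operator seen in frequency. -/
def freqAdjoint (θ : PhaseSpace d → ℂ) (ζ : PhaseSpace d) : ℂ :=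
  -fderiv ℝ θ ζ (shearGen d ζ) - (4 * Real.pi ^ 2 * velSq ζ : ℝ) * θ ζ

/-- `freqAdjoint` as an operator on Schwartz functions. -/
def freqAdjointS (θ : 𝓢(PhaseSpace d, ℂ)) : 𝓢(PhaseSpace d, ℂ) :=
  (∑ i : Fin d, -coordDeriv (Sum.inr i) (coordMul (Sum.inl i) θ))
    + ∑ i : Fin d, (-(4 * Real.pi ^ 2) : ℂ) • coordMul (Sum.inr i) (coordMul (Sum.inr i) θ)

/-- The field (0, ξ) is divergence free: multiplication by ξ_i commutes with the derivative in η_i.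
The divergence form is the convenient one for the Fourier transform. -/
lemma freqAdjointS_apply (θ : 𝓢(PhaseSpace d, ℂ)) (ζ : PhaseSpace d) :
    freqAdjointS θ ζ = freqAdjoint θ ζ := by
  have h1 : ∀ i : Fin d, coordDeriv (Sum.inr i) (coordMul (Sum.inl i) θ) ζ
      = (ζ (Sum.inl i) : ℂ) * fderiv ℝ θ ζ (EuclideanSpace.single (Sum.inr i) 1) := by
    intro i
    have e : (coordMul (Sum.inl i) θ : PhaseSpace d → ℂ)
        = fun z => ((EuclideanSpace.proj (𝕜 := ℝ) (Sum.inl i) : PhaseSpace d →L[ℝ] ℝ) z : ℂ) * θ z := by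
      ext z; rw [coordMul_apply]; rfl
    have hl : HasFDerivAt (fun z : PhaseSpace d =>
        ((EuclideanSpace.proj (𝕜 := ℝ) (Sum.inl i) : PhaseSpace d →L[ℝ] ℝ) z : ℂ))
        (Complex.ofRealCLM.comp (EuclideanSpace.proj (𝕜 := ℝ) (Sum.inl i))) ζ :=
      (Complex.ofRealCLM.comp (EuclideanSpace.proj (𝕜 := ℝ) (Sum.inl i))).hasFDerivAt
    rw [← partialDeriv_schwartz, e, partialDeriv_mul _ _ θ.differentiable]
    · simp only [partialDeriv]
      rw [hl.fderiv]
      simp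
    · exact (Complex.ofRealCLM.comp (EuclideanSpace.proj (𝕜 := ℝ) (Sum.inl i))).differentiable
  rw [freqAdjointS, freqAdjoint, shearGen_eq_sum, map_sum]
  simp only [_root_.add_apply, _root_.sum_apply, _root_.neg_apply, h1,
    _root_.smul_apply, coordMul_apply, velSq]
  rw [sub_eq_add_neg, Finset.sum_neg_distrib]
  congr 1
  · congr 1
    exact Finset.sum_congr rfl fun i _ => by rw [map_smul, Complex.real_smul]
  · push_cast
    rw [Finset.mul_sum, Finset.sum_mul, ← Finset.sum_neg_distrib]
    exact Finset.sum_congr rfl fun i _ => by rw [smul_eq_mul]; ring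

lemma coordDeriv_fourier {ι : Type*} [Fintype ι] [DecidableEq ι] (i : ι)
    (f : 𝓢(EuclideanSpace ℝ ι, ℂ)) :
    coordDeriv i (𝓕 f) = 𝓕 (-(2 * Real.pi * Complex.I) • coordMul i f) :=
  lineDerivOp_fourier_eq f _

lemma fourier_coordDeriv {ι : Type*} [Fintype ι] [DecidableEq ι] (i : ι)
    (f : 𝓢(EuclideanSpace ℝ ι, ℂ)) :
    𝓕 (coordDeriv i f) = (2 * Real.pi * Complex.I) • coordMul i (𝓕 f) :=
  fourier_lineDerivOp_eq f _

/-- A derivative in η_i becomes multiplication by 2πi v_i, and a derivative in x_i of the transform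
comes from multiplication by -2πi ξ_i. Hence v·∇_x turns into -ξ·∇_η and Δ_v into -4π²|η|². -/
lemma kolmogorovAdjoint_fourier (θ : 𝓢(PhaseSpace d, ℂ)) (z : PhaseSpace d) :
    kolmogorovAdjoint (𝓕 θ : 𝓢(PhaseSpace d, ℂ)) z = 𝓕 (freqAdjointS θ) z := by
  have hF : ∀ (c : ℂ) (f : 𝓢(PhaseSpace d, ℂ)), 𝓕 (c • f) = c • 𝓕 f := fun c f =>
    FourierTransform.fourier_smul c f
  have hs : 𝓕 (freqAdjointS θ) = (∑ i : Fin d, -𝓕 (coordDeriv (Sum.inr i) (coordMul (Sum.inl i) θ)))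
      + ∑ i : Fin d, (-(4 * Real.pi ^ 2) : ℂ) • 𝓕 (coordMul (Sum.inr i) (coordMul (Sum.inr i) θ)) := by
    have hlin : ∀ f : 𝓢(PhaseSpace d, ℂ), 𝓕 f = fourierCLM ℂ 𝓢(PhaseSpace d, ℂ) f := fun f => rfl
    simp only [hlin, freqAdjointS, map_add, map_sum, map_neg, map_smul]
  rw [hs]
  simp only [_root_.add_apply, _root_.sum_apply, _root_.neg_apply,
    _root_.smul_apply, fourier_coordDeriv, kolmogorovAdjoint, partialDeriv_schwartz,
    coordDeriv_fourier, hF, coordMul_apply]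
  congr 1
  · refine Finset.sum_congr rfl fun i _ => ?_
    simp only [smul_eq_mul]
    ring
  · refine Finset.sum_congr rfl fun i _ => ?_
    have hm : coordMul (Sum.inr i) (-(2 * Real.pi * Complex.I) • coordMul (Sum.inr i) θ)
        = -(2 * Real.pi * Complex.I) • coordMul (Sum.inr i) (coordMul (Sum.inr i) θ) := by
      ext z
      simp only [coordMul_apply, _root_.smul_apply, smul_eq_mul]
      ring
    rw [← hF, coordDeriv_fourier, hm, hF, hF, _root_.smul_apply, _root_.smul_apply, smul_eq_mul, smul_eq_mul, smul_eq_mul, ← mul_assoc]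
    congr 1
    ring_nf
    rw [Complex.I_sq]
    ring

/-- The weak formulation in frequency. -/
lemma IsKolmogorovSolution.weak_fourier {g₀ : PhaseL2 d} {g : ℝ → PhaseL2 d}
    (h : IsKolmogorovSolution g₀ g) (θ : 𝓢(PhaseSpace d, ℂ)) {t : ℝ} (ht : 0 ≤ t) :
    ∫ ζ, (𝓕 (g t) : PhaseL2 d) ζ * θ ζ = (∫ ζ, (𝓕 g₀ : PhaseL2 d) ζ * θ ζ)
      + ∫ s in (0 : ℝ)..t, ∫ ζ, (𝓕 (g s) : PhaseL2 d) ζ * freqAdjoint θ ζ := by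
  rw [integral_fourierLp_mul, integral_fourierLp_mul, h.weak_schwartz _ ht]
  congr 1
  refine intervalIntegral.integral_congr fun s _ => ?_
  simp only [← freqAdjointS_apply, kolmogorovAdjoint_fourier]
  exact (integral_fourierLp_mul _ _).symm

/-- The phase `∫₀ʳ |η - σ ξ|² dσ`. -/
def phaseBack (r : ℝ) (ζ : PhaseSpace d) : ℝ :=
  r * velSq ζ - r ^ 2 * posVel ζ + r ^ 3 / 3 * posSq ζ

/-- The transported test function, solving the adjoint equation in frequency. -/
def transported (θ : PhaseSpace d → ℂ) (r : ℝ) (ζ : PhaseSpace d) : ℂ :=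
  θ (ζ - r • shearGen d ζ) * (Real.exp (-(4 * Real.pi ^ 2 * phaseBack r ζ)) : ℂ)

lemma velSq_sub_smul_shearGen (ζ : PhaseSpace d) (r : ℝ) :
    velSq (ζ - r • shearGen d ζ) = velSq ζ - 2 * r * posVel ζ + r ^ 2 * posSq ζ := by
  rw [sub_eq_add_neg, ← neg_smul, velSq_add_smul_shearGen]
  ring

/-- Here the generator acts before the flow: moving r shifts the argument of θ along the shear, and
the phase grows at the rate |η|² evaluated at the shifted point. -/
lemma hasDerivAt_transported {θ : PhaseSpace d → ℂ} (hθ : Differentiable ℝ θ) (r : ℝ)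
    (ζ : PhaseSpace d) :
    HasDerivAt (fun r => transported θ r ζ) (transported (freqAdjoint θ) r ζ) r := by
  have h1 : HasDerivAt (fun r : ℝ => ζ - r • shearGen d ζ) (-shearGen d ζ) r := by
    simpa using ((hasDerivAt_id r).smul_const (shearGen d ζ)).const_sub ζ
  have h2 : HasDerivAt (fun r : ℝ => θ (ζ - r • shearGen d ζ))
      (fderiv ℝ θ (ζ - r • shearGen d ζ) (-shearGen d ζ)) r :=
    (hθ _).hasFDerivAt.comp_hasDerivAt r h1
  have h3 : HasDerivAt (fun r : ℝ => -(4 * Real.pi ^ 2 * phaseBack r ζ))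
      (-(4 * Real.pi ^ 2 * velSq (ζ - r • shearGen d ζ))) r := by
    have a1 := (hasDerivAt_id r).mul_const (velSq ζ)
    have a2 := (hasDerivAt_pow 2 r).mul_const (posVel ζ)
    have a3 := ((hasDerivAt_pow 3 r).div_const 3).mul_const (posSq ζ)
    refine ((((a1.sub a2).add a3).const_mul (4 * Real.pi ^ 2)).neg).congr_deriv ?_
    rw [velSq_sub_smul_shearGen]
    push_cast
    ring
  refine (h2.mul h3.exp.ofReal_comp).congr_deriv ?_
  simp only [transported, freqAdjoint, map_sub, map_smul, shearGen_shearGen, smul_zero, sub_zero,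
    map_neg]
  push_cast
  ring

/-- The generator commutes with its flow. Along the shear direction the phase has derivative 2r ξ·η
- r²|ξ|², exactly the difference of |η|² between the two ends of the characteristic. With
`hasDerivAt_transported` this says that the transported function solves the adjoint equation. -/
lemma freqAdjoint_transported {θ : PhaseSpace d → ℂ} (hθ : Differentiable ℝ θ) (r : ℝ)
    (ζ : PhaseSpace d) :
    freqAdjoint (transported θ r) ζ = transported (freqAdjoint θ) r ζ := by
  have hd : DifferentiableAt ℝ (transported θ r) ζ := by
    have h1 : Differentiable ℝ fun ζ : PhaseSpace d => phaseBack r ζ := by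
      unfold phaseBack
      have e1 : Differentiable ℝ (velSq (d := d)) := contDiff_velSq.differentiable (n := 1) (by simp)
      have e2 : Differentiable ℝ (posVel (d := d)) := contDiff_posVel.differentiable (n := 1) (by simp)
      have e3 : Differentiable ℝ (posSq (d := d)) := contDiff_posSq.differentiable (n := 1) (by simp)
      fun_prop
    have h2 : Differentiable ℝ fun ζ : PhaseSpace d =>
        (Real.exp (-(4 * Real.pi ^ 2 * phaseBack r ζ)) : ℂ) :=
      Complex.ofRealCLM.differentiable.comp (by fun_prop)
    have h3 : Differentiable ℝ fun ζ : PhaseSpace d => θ (ζ - r • shearGen d ζ) :=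
      hθ.comp (by fun_prop)
    exact (h3.mul h2) ζ
  have hl : HasDerivAt (fun ε : ℝ => transported θ r (ζ + ε • shearGen d ζ))
      ((fderiv ℝ θ (ζ - r • shearGen d ζ) (shearGen d ζ)
        - (4 * Real.pi ^ 2 * (2 * r * posVel ζ - r ^ 2 * posSq ζ) : ℝ) * θ (ζ - r • shearGen d ζ))
        * (Real.exp (-(4 * Real.pi ^ 2 * phaseBack r ζ)) : ℂ)) 0 := by
    have h1 : HasDerivAt (fun ε : ℝ => ζ + ε • shearGen d ζ - r • shearGen d ζ)
        (shearGen d ζ) 0 := by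
      simpa using (((hasDerivAt_id (0 : ℝ)).smul_const (shearGen d ζ)).const_add ζ).sub_const
        (r • shearGen d ζ)
    have h2 : HasDerivAt (fun ε : ℝ => θ (ζ + ε • shearGen d ζ - r • shearGen d ζ))
        (fderiv ℝ θ (ζ - r • shearGen d ζ) (shearGen d ζ)) 0 := by
      have e : ζ - r • shearGen d ζ = ζ + (0 : ℝ) • shearGen d ζ - r • shearGen d ζ := by simp
      rw [e]
      exact (hθ _).hasFDerivAt.comp_hasDerivAt (0 : ℝ) h1
    have h3 : HasDerivAt (fun ε : ℝ => -(4 * Real.pi ^ 2 * phaseBack r (ζ + ε • shearGen d ζ)))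
        (-(4 * Real.pi ^ 2 * (2 * r * posVel ζ - r ^ 2 * posSq ζ))) 0 := by
      simp only [phaseBack, velSq_add_smul_shearGen, posVel_add_smul_shearGen,
        posSq_add_smul_shearGen]
      have a0 := hasDerivAt_id (0 : ℝ)
      have a1 := ((((a0.const_mul 2).mul_const (posVel ζ)).const_add (velSq ζ)).add
        ((hasDerivAt_pow 2 (0 : ℝ)).mul_const (posSq ζ))).const_mul r
      have a2 := ((a0.mul_const (posSq ζ)).const_add (posVel ζ)).const_mul (r ^ 2)
      refine (((a1.sub a2).add_const (r ^ 3 / 3 * posSq ζ)).const_mul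
        (4 * Real.pi ^ 2)).neg.congr_deriv ?_
      push_cast
      ring
    have h4 := h2.mul h3.exp.ofReal_comp
    simp only [zero_smul, add_zero] at h4
    refine (h4.congr_deriv ?_).congr_of_eventuallyEq (Filter.Eventually.of_forall fun ε => ?_)
    · push_cast
      ring
    · simp only [transported, Pi.mul_apply, map_add, map_smul, shearGen_shearGen, smul_zero,
        add_zero]
  have hf := (HasDerivAt.unique (by simpa using! hd.hasFDerivAt.hasLineDerivAt (shearGen d ζ)) hl)
  rw [freqAdjoint, hf]
  simp only [transported, freqAdjoint, map_sub, map_smul, shearGen_shearGen, smul_zero, sub_zero,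
    velSq_sub_smul_shearGen]
  push_cast
  ring

end FourierSide

/-! ### Explicit solution formula in frequency. -/

section Representation

open SchwartzMap FourierTransform

variable {d : ℕ}

lemma continuous_transported {θ : PhaseSpace d → ℂ} (hθ : Continuous θ) :
    Continuous fun q : ℝ × PhaseSpace d => transported θ q.1 q.2 := by
  have e1 : Continuous (velSq (d := d)) := (contDiff_velSq (n := 0)).continuous
  have e2 : Continuous (posVel (d := d)) := (contDiff_posVel (n := 0)).continuous
  have e3 : Continuous (posSq (d := d)) := (contDiff_posSq (n := 0)).continuous
  unfold transported phaseBack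
  fun_prop

lemma contDiff_transported {θ : PhaseSpace d → ℂ} (hθ : ContDiff ℝ ((⊤ : ℕ∞) : WithTop ℕ∞) θ)
    (r : ℝ) : ContDiff ℝ ((⊤ : ℕ∞) : WithTop ℕ∞) (transported θ r) := by
  have h1 : ContDiff ℝ ((⊤ : ℕ∞) : WithTop ℕ∞) fun ζ : PhaseSpace d =>
      -(4 * Real.pi ^ 2 * phaseBack r ζ) := by
    unfold phaseBack
    fun_prop
  have h2 : ContDiff ℝ ((⊤ : ℕ∞) : WithTop ℕ∞) fun ζ : PhaseSpace d =>
      (Real.exp (-(4 * Real.pi ^ 2 * phaseBack r ζ)) : ℂ) :=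
    Complex.ofRealCLM.contDiff.comp h1.exp
  exact (hθ.comp (by fun_prop)).mul h2

lemma exists_compact_transported_eq_zero {θ : PhaseSpace d → ℂ} (hs : HasCompactSupport θ) (ρ : ℝ) :
    ∃ K : Set (PhaseSpace d), IsCompact K ∧
      ∀ r, |r| ≤ ρ → ∀ ζ ∉ K, transported θ r ζ = 0 := by
  refine ⟨(fun q : ℝ × PhaseSpace d => q.2 + q.1 • shearGen d q.2) ''
    (Set.Icc (-ρ) ρ ×ˢ tsupport θ), (isCompact_Icc.prod hs).image (by fun_prop), ?_⟩
  intro r hr ζ hζ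
  have h0 : θ (ζ - r • shearGen d ζ) = 0 := by
    by_contra hne
    refine hζ ⟨(r, ζ - r • shearGen d ζ), ⟨abs_le.1 hr, subset_tsupport _ hne⟩, ?_⟩
    simp
  rw [transported, h0, zero_mul]

lemma hasCompactSupport_transported {θ : PhaseSpace d → ℂ} (hs : HasCompactSupport θ) (r : ℝ) :
    HasCompactSupport (transported θ r) := by
  obtain ⟨K, hK, h⟩ := exists_compact_transported_eq_zero hs |r|
  exact HasCompactSupport.intro hK (h r le_rfl)

/-- For bounded r the characteristics issued from the support of θ stay in one compact set. This
supplies the dominating function for limits and derivatives in r. -/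
lemma exists_bound_transported {θ : PhaseSpace d → ℂ} (hθ : Continuous θ)
    (hs : HasCompactSupport θ) (ρ : ℝ) :
    ∃ G : PhaseSpace d → ℝ, MemLp G 2 ∧ ∀ r, |r| ≤ ρ → ∀ ζ, ‖transported θ r ζ‖ ≤ G ζ := by
  obtain ⟨K, hK, h⟩ := exists_compact_transported_eq_zero hs ρ
  obtain ⟨C, hC⟩ := (isCompact_Icc (a := -ρ) (b := ρ)).prod hK |>.exists_bound_of_continuousOn
    (continuous_transported hθ).continuousOn
  refine ⟨K.indicator fun _ => C, memLp_indicator_const 2 hK.measurableSet C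
    (Or.inr hK.measure_lt_top.ne), ?_⟩
  intro r hr ζ
  by_cases hζ : ζ ∈ K
  · rw [Set.indicator_of_mem hζ]
    exact hC (r, ζ) ⟨abs_le.1 hr, hζ⟩
  · rw [Set.indicator_of_notMem hζ, h r hr ζ hζ, norm_zero]

lemma memLp_transported {θ : PhaseSpace d → ℂ} (hθ : Continuous θ) (hs : HasCompactSupport θ)
    (r : ℝ) : MemLp (transported θ r) 2 :=
  Continuous.memLp_of_hasCompactSupport
    ((continuous_transported hθ).comp (Continuous.prodMk_right r))
    (hasCompactSupport_transported hs r)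

lemma eventually_abs_le_add_one (r₀ : ℝ) : ∀ᶠ r in nhds r₀, |r| ≤ |r₀| + 1 := by
  filter_upwards [Metric.ball_mem_nhds r₀ one_pos] with r hr
  rw [Metric.mem_ball, Real.dist_eq] at hr
  have := abs_sub_abs_le_abs_sub r r₀
  linarith

lemma continuous_integral_mul_transported {θ : PhaseSpace d → ℂ} (hθ : Continuous θ)
    (hs : HasCompactSupport θ) (f : PhaseL2 d) :
    Continuous fun r => ∫ ζ, f ζ * transported θ r ζ := by
  rw [continuous_iff_continuousAt]
  intro r₀
  obtain ⟨G, hG, hGb⟩ := exists_bound_transported hθ hs (|r₀| + 1)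
  refine tendsto_integral_filter_of_dominated_convergence (fun ζ => ‖f ζ‖ * G ζ)
    (Filter.Eventually.of_forall fun r => ?_) ?_ ((Lp.memLp f).norm.integrable_mul hG)
    (Filter.Eventually.of_forall fun ζ => ?_)
  · exact (Lp.aestronglyMeasurable f).mul (memLp_transported hθ hs r).1
  · filter_upwards [eventually_abs_le_add_one r₀] with r hr
    refine Filter.Eventually.of_forall fun ζ => ?_
    rw [norm_mul]
    exact mul_le_mul_of_nonneg_left (hGb r hr ζ) (norm_nonneg _)
  · exact (((continuous_transported hθ).comp (Continuous.prodMk_left ζ)).tendsto r₀).const_mul _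

/-- Joint continuity is needed because the solution and the test function will vary in time
simultaneously, and the solution is only continuous in time. -/
lemma continuousOn_integral_mul_transported {θ : PhaseSpace d → ℂ} (hθ : Continuous θ)
    (hs : HasCompactSupport θ) {h : ℝ → PhaseL2 d} {S : Set ℝ} (hh : ContinuousOn h S) :
    ContinuousOn (fun q : ℝ × ℝ => ∫ ζ, h q.1 ζ * transported θ q.2 ζ) (S ×ˢ Set.univ) := by
  rintro ⟨σ₀, r₀⟩ ⟨hσ₀, -⟩
  obtain ⟨G, hG, hGb⟩ := exists_bound_transported hθ hs (|r₀| + 1)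
  have hfst : Filter.Tendsto (fun q : ℝ × ℝ => h q.1)
      (nhdsWithin (σ₀, r₀) (S ×ˢ Set.univ)) (nhds (h σ₀)) :=
    ((hh σ₀ hσ₀).comp continuous_fst.continuousWithinAt
      (fun q (hq : q ∈ S ×ˢ Set.univ) => hq.1) :
      ContinuousWithinAt (fun q : ℝ × ℝ => h q.1) (S ×ˢ Set.univ) (σ₀, r₀))
  have hsnd : Filter.Tendsto (fun q : ℝ × ℝ => q.2)
      (nhdsWithin (σ₀, r₀) (S ×ˢ Set.univ)) (nhds r₀) :=
    continuous_snd.continuousAt.mono_left nhdsWithin_le_nhds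
  have h1 : Filter.Tendsto (fun q : ℝ × ℝ => ∫ ζ, (h q.1 - h σ₀) ζ * transported θ q.2 ζ)
      (nhdsWithin (σ₀, r₀) (S ×ˢ Set.univ)) (nhds 0) := by
    have hlim : Filter.Tendsto (fun q : ℝ × ℝ => ‖h q.1 - h σ₀‖ * (eLpNorm G 2 volume).toReal)
        (nhdsWithin (σ₀, r₀) (S ×ˢ Set.univ)) (nhds 0) := by
      have := (tendsto_iff_norm_sub_tendsto_zero.1 hfst).mul_const (eLpNorm G 2 volume).toReal
      simpa using this
    refine squeeze_zero_norm' ?_ hlim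
    filter_upwards [hsnd.eventually (eventually_abs_le_add_one r₀)] with q hq
    refine (norm_integral_Lp_mul_le _ (memLp_transported hθ hs _)).trans ?_
    gcongr
    · exact hG.eLpNorm_lt_top.ne
    · exact eLpNorm_mono_real (hGb _ hq)
  have h2 := ((continuous_integral_mul_transported hθ hs (h σ₀)).tendsto r₀).comp hsnd
  have h3 := h1.add h2
  rw [zero_add] at h3
  refine h3.congr fun q => ?_
  simp only [Function.comp]
  rw [integral_Lp_sub_mul _ _ (memLp_transported hθ hs _)]
  ring

lemma continuous_freqAdjoint {θ : PhaseSpace d → ℂ}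
    (hθ : ContDiff ℝ ((⊤ : ℕ∞) : WithTop ℕ∞) θ) : Continuous (freqAdjoint θ) := by
  have e1 : Continuous (velSq (d := d)) := (contDiff_velSq (n := 0)).continuous
  have e2 : Continuous (fderiv ℝ θ) := hθ.continuous_fderiv (by simp)
  have e3 := hθ.continuous
  unfold freqAdjoint
  fun_prop

lemma hasCompactSupport_freqAdjoint {θ : PhaseSpace d → ℂ} (hs : HasCompactSupport θ) :
    HasCompactSupport (freqAdjoint θ) := by
  refine HasCompactSupport.intro (K := tsupport θ) hs fun ζ hζ => ?_
  have h1 : fderiv ℝ θ ζ = 0 := by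
    by_contra hne
    exact hζ (tsupport_fderiv_subset ℝ (subset_tsupport (fderiv ℝ θ) hne))
  rw [freqAdjoint, h1, image_eq_zero_of_notMem_tsupport hζ]
  simp

lemma hasDerivAt_integral_mul_transported {θ : PhaseSpace d → ℂ}
    (hθ : ContDiff ℝ ((⊤ : ℕ∞) : WithTop ℕ∞) θ) (hs : HasCompactSupport θ) (f : PhaseL2 d)
    (r : ℝ) :
    HasDerivAt (fun r => ∫ ζ, f ζ * transported θ r ζ)
      (∫ ζ, f ζ * transported (freqAdjoint θ) r ζ) r := by
  have hB := continuous_freqAdjoint hθ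
  have hBs := hasCompactSupport_freqAdjoint hs
  obtain ⟨G, hG, hGb⟩ := exists_bound_transported hB hBs (|r| + 1)
  refine (hasDerivAt_integral_of_dominated_loc_of_deriv_le (bound := fun ζ => ‖f ζ‖ * G ζ)
    (F := fun r ζ => f ζ * transported θ r ζ)
    (F' := fun r ζ => f ζ * transported (freqAdjoint θ) r ζ)
    (s := {r' | |r'| ≤ |r| + 1})
    (eventually_abs_le_add_one r) (Filter.Eventually.of_forall fun r => ?_) ?_ ?_
    (Filter.Eventually.of_forall fun ζ r' hr' => ?_) ((Lp.memLp f).norm.integrable_mul hG)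
    (Filter.Eventually.of_forall fun ζ r' _ => ?_)).2
  · exact (Lp.aestronglyMeasurable f).mul (memLp_transported hθ.continuous hs r).1
  · exact (Lp.memLp f).integrable_mul (memLp_transported hθ.continuous hs r)
  · exact (Lp.aestronglyMeasurable f).mul (memLp_transported hB hBs r).1
  · rw [norm_mul]
    exact mul_le_mul_of_nonneg_left (hGb r' hr' ζ) (norm_nonneg _)
  · exact (hasDerivAt_transported (hθ.differentiable (by simp)) r' ζ).const_mul _

/-- The duality formula along the transport flow. -/
lemma IsKolmogorovSolution.integral_mul_eq_transported {g₀ : PhaseL2 d} {g : ℝ → PhaseL2 d}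
    (hg : IsKolmogorovSolution g₀ g) {θ : PhaseSpace d → ℂ}
    (hθ : ContDiff ℝ ((⊤ : ℕ∞) : WithTop ℕ∞) θ) (hs : HasCompactSupport θ) {t : ℝ} (ht : 0 ≤ t) :
    ∫ ζ, (𝓕 (g t) : PhaseL2 d) ζ * θ ζ = ∫ ζ, (𝓕 g₀ : PhaseL2 d) ζ * transported θ t ζ := by
  set h : ℝ → PhaseL2 d := fun s => 𝓕 (g s) with hh
  have hhc : ContinuousOn h (Set.Ici 0) :=
    (Lp.fourierTransformₗᵢ (PhaseSpace d) ℂ).continuous.comp_continuousOn hg.continuousOn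
  have hB := continuous_freqAdjoint hθ
  have hBs := hasCompactSupport_freqAdjoint hs
  have hweak : ∀ r x b, 0 ≤ x → x ≤ b → (∫ ζ, (h b - h x) ζ * transported θ r ζ)
      = ∫ σ in x..b, ∫ ζ, h σ ζ * transported (freqAdjoint θ) r ζ := by
    intro r x b hx hxb
    set θS : 𝓢(PhaseSpace d, ℂ) :=
      (hasCompactSupport_transported hs r).toSchwartzMap (contDiff_transported hθ r)
    have e1 : ∀ s, 0 ≤ s → ∫ ζ, h s ζ * transported θ r ζ = (∫ ζ, (𝓕 g₀ : PhaseL2 d) ζ *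
        transported θ r ζ) + ∫ σ in (0 : ℝ)..s, ∫ ζ, h σ ζ * transported (freqAdjoint θ) r ζ := by
      intro s hs0
      have := hg.weak_fourier θS hs0
      simp only [show (θS : PhaseSpace d → ℂ) = transported θ r from rfl,
        fun ζ => freqAdjoint_transported (hθ.differentiable (by simp)) r ζ] at this
      exact this
    have hint : ∀ s, 0 ≤ s → IntervalIntegrable
        (fun σ => ∫ ζ, h σ ζ * transported (freqAdjoint θ) r ζ) volume 0 s := by
      intro s hs0
      refine ((continuousOn_integral_Lp_mul hhc (memLp_transported hB hBs r)).mono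
        ?_).intervalIntegrable
      rw [Set.uIcc_of_le hs0]
      exact Set.Icc_subset_Ici_self
    rw [integral_Lp_sub_mul _ _ (memLp_transported hθ.continuous hs r), e1 b (hx.trans hxb), e1 x hx,
      add_sub_add_left_eq_sub, intervalIntegral.integral_interval_sub_left
        (hint b (hx.trans hxb)) (hint x hx)]
  -- The pairing of the solution with the backward adjoint solution that equals θ at time t. It is
  -- shown to be constant on [0, t] by means of its right derivative.
  set Λ : ℝ → ℂ := fun s => ∫ ζ, h s ζ * transported θ (t - s) ζ with hΛ
  have hΛc : ContinuousOn Λ (Set.Icc 0 t) := by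
    refine (continuousOn_integral_mul_transported hθ.continuous hs hhc).comp
      (f := fun s : ℝ => (s, t - s)) (by fun_prop) fun s hs' => ⟨hs'.1, trivial⟩
  have hΛd : ∀ x ∈ Set.Ico 0 t, HasDerivWithinAt Λ 0 (Set.Ici x) x := by
    intro x hx
    set p : ℂ := ∫ ζ, h x ζ * transported (freqAdjoint θ) (t - x) ζ with hp
    have d1 : HasDerivWithinAt (fun b => ∫ ζ, h x ζ * transported θ (t - b) ζ) (-p)
        (Set.Ici x) x := by
      have h1 := hasDerivAt_integral_mul_transported hθ hs (h x) (t - x)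
      have h2 : HasDerivAt (fun b : ℝ => t - b) (-1) x := by
        simpa using (hasDerivAt_id x).const_sub t
      have := h1.scomp x h2
      simp only [neg_smul, one_smul] at this
      exact this.hasDerivWithinAt
    -- The product rule without differentiating h: by the weak formulation, the increment of h
    -- against the moving test function is an integral over [x, b] of a jointly continuous pairing,
    -- so its derivative at x is the value p there. It cancels `d1`.
    have d2 : HasDerivWithinAt (fun b => ∫ ζ, (h b - h x) ζ * transported θ (t - b) ζ) p
        (Set.Ici x) x := by
      rw [hasDerivWithinAt_iff_isLittleO, Asymptotics.isLittleO_iff]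
      intro ε hε
      have hc := continuousOn_integral_mul_transported hB hBs hhc
      obtain ⟨δ, hδ, hδ'⟩ := Metric.continuousOn_iff.1 hc (x, t - x) ⟨hx.1, trivial⟩ ε hε
      have hmem : Set.Ico x (x + δ) ∈ nhdsWithin x (Set.Ici x) := Ico_mem_nhdsGE (by linarith)
      filter_upwards [hmem] with b hb
      have e0 : ∫ ζ, (h x - h x) ζ * transported θ (t - x) ζ = 0 := by
        rw [hweak _ x x hx.1 le_rfl, intervalIntegral.integral_same]
      rw [e0, hweak _ x b hx.1 hb.1, sub_zero, ← intervalIntegral.integral_const,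
        ← intervalIntegral.integral_sub _ intervalIntegrable_const]
      · rw [Real.norm_eq_abs]
        refine intervalIntegral.norm_integral_le_of_norm_le_const fun σ hσ => ?_
        rw [Set.uIoc_of_le hb.1] at hσ
        rw [← dist_eq_norm]
        refine (hδ' (σ, t - b) ⟨hx.1.trans hσ.1.le, trivial⟩ ?_).le
        rw [Prod.dist_eq, max_lt_iff, Real.dist_eq, Real.dist_eq]
        constructor
        · rw [abs_of_nonneg (by linarith [hσ.1])]
          linarith [hσ.2, hb.2]
        · rw [show t - b - (t - x) = -(b - x) by ring, abs_neg, abs_of_nonneg (by linarith [hb.1])]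
          linarith [hb.2]
      · refine ((continuousOn_integral_Lp_mul hhc (memLp_transported hB hBs _)).mono
          ?_).intervalIntegrable
        rw [Set.uIcc_of_le hb.1]
        exact fun y hy => hx.1.trans hy.1
    have d3 := d1.add d2
    rw [neg_add_cancel] at d3
    refine d3.congr_of_eventuallyEq (Filter.Eventually.of_forall fun b => ?_) ?_
    all_goals
      simp only [Pi.add_apply]
      rw [integral_Lp_sub_mul _ _ (memLp_transported hθ.continuous hs _)]
      simp [hΛ]
  have hconst := constant_of_has_deriv_right_zero hΛc hΛd t (Set.right_mem_Icc.2 ht)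
  simp only [hΛ, sub_self, sub_zero] at hconst
  have h0 : ∀ ζ, transported θ 0 ζ = θ ζ := by
    intro ζ
    simp [transported, phaseBack]
  simp only [h0] at hconst
  rw [show (𝓕 g₀ : PhaseL2 d) = h 0 by simp only [hh, hg.initial]]
  exact hconst

/-- The shear flow in frequency preserves Lebesgue measure. -/
lemma measurePreserving_shear (r : ℝ) :
    MeasurePreserving (fun ζ : PhaseSpace d => ζ + r • shearGen d ζ) volume volume := by
  set L : PhaseSpace d →ₗ[ℝ] PhaseSpace d := LinearMap.id + r • (shearGen d).toLinearMap with hL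
  have hdet : LinearMap.det L = 1 := by
    set b := (EuclideanSpace.basisFun (Fin d ⊕ Fin d) ℝ).toBasis
    rw [← LinearMap.det_toMatrix b]
    have : LinearMap.toMatrix b b L = Matrix.fromBlocks 1 0 (r • 1) 1 := by
      ext (i | i) (j | j) <;>
        simp [LinearMap.toMatrix_apply, b, hL, Matrix.one_apply]
    rw [this, Matrix.det_fromBlocks_zero₁₂]
    simp
  refine ⟨by fun_prop, ?_⟩
  have := Measure.map_linearMap_addHaar_eq_smul_addHaar (volume : Measure (PhaseSpace d))
    (f := L) (by rw [hdet]; exact one_ne_zero)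
  rw [hdet] at this
  have hf : (fun ζ : PhaseSpace d => ζ + r • shearGen d ζ) = L := rfl
  rw [hf]
  simpa using this

lemma measurableEmbedding_shear (r : ℝ) :
    MeasurableEmbedding (fun ζ : PhaseSpace d => ζ + r • shearGen d ζ) := by
  refine MeasurableEmbedding.of_measurable_inverse (g := fun ζ => ζ - r • shearGen d ζ)
    (by fun_prop) ?_ (by fun_prop) fun ζ => by simp
  convert MeasurableSet.univ
  rw [Set.range_eq_univ]
  exact fun ζ => ⟨ζ - r • shearGen d ζ, by simp⟩

/-- The decay exponent `∫₀ʳ |η + σ ξ|² dσ` of the Kolmogorov flow in frequency. -/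
def phaseFwd (r : ℝ) (ζ : PhaseSpace d) : ℝ :=
  r * velSq ζ + r ^ 2 * posVel ζ + r ^ 3 / 3 * posSq ζ

/-- The same characteristic parametrised from its other end; this is the phase after the change of
variables in the duality formula. -/
lemma phaseBack_shear (r : ℝ) (ζ : PhaseSpace d) :
    phaseBack r (ζ + r • shearGen d ζ) = phaseFwd r ζ := by
  rw [phaseBack, velSq_add_smul_shearGen, posVel_add_smul_shearGen, posSq_add_smul_shearGen,
    phaseFwd]
  ring

lemma norm_sq_eq_posSq_add_velSq (ζ : PhaseSpace d) : ‖ζ‖ ^ 2 = posSq ζ + velSq ζ := by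
  rw [EuclideanSpace.norm_sq_eq, Fintype.sum_sum_type]
  simp [posSq, velSq]

lemma phaseFwd_nonneg {r : ℝ} (hr : 0 ≤ r) (ζ : PhaseSpace d) : 0 ≤ phaseFwd r ζ := by
  simp only [phaseFwd, velSq, posVel, posSq, Finset.mul_sum, ← Finset.sum_add_distrib]
  refine Finset.sum_nonneg fun i _ => ?_
  have : 0 ≤ r * ((ζ (Sum.inr i) + r * ζ (Sum.inl i) / 2) ^ 2 + (r * ζ (Sum.inl i)) ^ 2 / 12) := by
    positivity
  linarith

/-- Hypoelliptic lower bound for the decay exponent. -/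
lemma phaseFwd_lower {r : ℝ} (hr : 0 ≤ r) (hr1 : r ≤ 1) (ζ : PhaseSpace d) :
    r ^ 3 / 16 * ‖ζ‖ ^ 2 ≤ phaseFwd r ζ := by
  rw [norm_sq_eq_posSq_add_velSq]
  simp only [phaseFwd, velSq, posVel, posSq, Finset.mul_sum, ← Finset.sum_add_distrib]
  refine Finset.sum_le_sum fun i _ => ?_
  set y := ζ (Sum.inr i)
  set x := ζ (Sum.inl i)
  have h1 : r ^ 3 ≤ r := by nlinarith [mul_nonneg hr hr]
  have h2 : r ^ 3 / 16 * y ^ 2 ≤ r / 16 * y ^ 2 := by gcongr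
  -- Completing the square after removing 1/16 from the coefficients of r y² and r³ x²: 13/48 is 1/3
  -- - 1/16, and it still exceeds 4/15.
  have h3 : 0 ≤ r * (15 / 16 * (y + 8 / 15 * (r * x)) ^ 2 + (13 / 48 - 4 / 15) * (r * x) ^ 2) :=
    mul_nonneg hr (add_nonneg (by positivity) (mul_nonneg (by norm_num) (sq_nonneg _)))
  linarith

lemma continuous_phaseFwd (r : ℝ) : Continuous (phaseFwd r : PhaseSpace d → ℝ) := by
  have e1 : Continuous (velSq (d := d)) := (contDiff_velSq (n := 0)).continuous
  have e2 : Continuous (posVel (d := d)) := (contDiff_posVel (n := 0)).continuous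
  have e3 : Continuous (posSq (d := d)) := (contDiff_posSq (n := 0)).continuous
  unfold phaseFwd
  fun_prop

/-- Explicit formula for the Fourier transform of the solution of the Kolmogorov equation. -/
theorem IsKolmogorovSolution.fourier_ae_eq {g₀ : PhaseL2 d} {g : ℝ → PhaseL2 d}
    (hg : IsKolmogorovSolution g₀ g) {t : ℝ} (ht : 0 ≤ t) :
    (𝓕 (g t) : PhaseL2 d) =ᵐ[volume] fun ζ =>
      (Real.exp (-(4 * Real.pi ^ 2 * phaseFwd t ζ)) : ℂ) *
        (𝓕 g₀ : PhaseL2 d) (ζ + t • shearGen d ζ) := by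
  have hmp := measurePreserving_shear (d := d) t
  have h2 : MemLp (fun ζ => (𝓕 g₀ : PhaseL2 d) (ζ + t • shearGen d ζ)) 2 volume :=
    (Lp.memLp (𝓕 g₀ : PhaseL2 d)).comp_measurePreserving hmp
  have hEc : Continuous fun ζ : PhaseSpace d =>
      (Real.exp (-(4 * Real.pi ^ 2 * phaseFwd t ζ)) : ℂ) := by
    have := continuous_phaseFwd (d := d) t
    fun_prop
  have hE1 : ∀ ζ : PhaseSpace d, ‖(Real.exp (-(4 * Real.pi ^ 2 * phaseFwd t ζ)) : ℂ)‖ ≤ 1 := by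
    intro ζ
    rw [Complex.norm_real, Real.norm_eq_abs, abs_of_pos (Real.exp_pos _), Real.exp_le_one_iff]
    have := phaseFwd_nonneg ht ζ
    have : 0 ≤ 4 * Real.pi ^ 2 * phaseFwd t ζ := by positivity
    linarith
  have h3 : MemLp (fun ζ => (Real.exp (-(4 * Real.pi ^ 2 * phaseFwd t ζ)) : ℂ) *
      (𝓕 g₀ : PhaseL2 d) (ζ + t • shearGen d ζ)) 2 volume := by
    refine h2.mono (hEc.aestronglyMeasurable.mul h2.1) (Filter.Eventually.of_forall fun ζ => ?_)
    rw [norm_mul]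
    exact mul_le_of_le_one_left (norm_nonneg _) (hE1 ζ)
  refine ae_eq_of_integral_contDiff_smul_eq ((Lp.memLp _).locallyIntegrable (by norm_num))
    (h3.locallyIntegrable (by norm_num)) fun θ hθ hs => ?_
  have hθ' : ContDiff ℝ ((⊤ : ℕ∞) : WithTop ℕ∞) fun ζ => (θ ζ : ℂ) :=
    Complex.ofRealCLM.contDiff.comp hθ
  have hs' : HasCompactSupport fun ζ => (θ ζ : ℂ) := hs.comp_left (g := Complex.ofReal) rfl
  have key := hg.integral_mul_eq_transported hθ' hs' ht
  -- Undoing the shear leaves θ unshifted, so the duality formula becomes a pairing of an explicit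
  -- function with an arbitrary test function.
  rw [← hmp.integral_comp (measurableEmbedding_shear t)
    fun ζ => (𝓕 g₀ : PhaseL2 d) ζ * transported (fun ζ => (θ ζ : ℂ)) t ζ] at key
  simp only [transported, phaseBack_shear, map_add, map_smul, shearGen_shearGen, smul_zero,
    add_zero, add_sub_cancel_right] at key
  simp only [Complex.real_smul]
  calc _ = ∫ ζ, (𝓕 (g t) : PhaseL2 d) ζ * (θ ζ : ℂ) := by simp only [mul_comm]
    _ = _ := key
    _ = _ := by
      refine integral_congr_ae (Filter.Eventually.of_forall fun ζ => ?_)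
      simp only
      ring

/-- Translation in time of a solution. -/
lemma IsKolmogorovSolution.shift {g₀ : PhaseL2 d} {g : ℝ → PhaseL2 d}
    (hg : IsKolmogorovSolution g₀ g) {s : ℝ} (hs : 0 ≤ s) :
    IsKolmogorovSolution (g s) fun τ => g (s + τ) where
  continuousOn := hg.continuousOn.comp (by fun_prop) fun τ (hτ : 0 ≤ τ) => add_nonneg hs hτ
  initial := by simp
  weak := by
    intro θ hθ hθs t ht
    have hm : MemLp (kolmogorovAdjoint θ) 2 volume :=
      memLp_kolmogorovAdjoint (hθs.toSchwartzMap hθ)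
    have hint : ∀ a, 0 ≤ a → IntervalIntegrable
        (fun σ => ∫ z, g σ z * kolmogorovAdjoint θ z) volume 0 a := by
      intro a ha
      refine ((continuousOn_integral_Lp_mul hg.continuousOn hm).mono ?_).intervalIntegrable
      rw [Set.uIcc_of_le ha]
      exact Set.Icc_subset_Ici_self
    rw [hg.weak θ hθ hθs _ (add_nonneg hs ht), hg.weak θ hθ hθs s hs, add_assoc]
    congr 1
    rw [← sub_eq_iff_eq_add', intervalIntegral.integral_interval_sub_left
      (hint _ (add_nonneg hs ht)) (hint s hs),
      intervalIntegral.integral_comp_add_left (fun σ => ∫ z, g σ z * kolmogorovAdjoint θ z) s,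
      add_zero]

end Representation

/-! ### Contraction, smoothing and interpolation. -/

section Smoothing

open FourierTransform

variable {d : ℕ}

/-- The shear preserves the L² norm, so only the supremum of the weight matters. With the weight of
the flow this gives contraction, and with an additional factor e^(a|ζ|) it gives smoothing. -/
lemma exists_Lp_eq_mul_comp_shear (f : PhaseL2 d) {w : PhaseSpace d → ℝ} (hw : Continuous w)
    {C : ℝ} (hC : ∀ ζ, |w ζ| ≤ C) (r : ℝ) :
    ∃ k : PhaseL2 d, k =ᵐ[volume] (fun ζ => (w ζ : ℂ) * f (ζ + r • shearGen d ζ)) ∧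
      ‖k‖ ≤ C * ‖f‖ := by
  have hmp := measurePreserving_shear (d := d) r
  have h2 : MemLp (fun ζ => f (ζ + r • shearGen d ζ)) 2 volume :=
    (Lp.memLp f).comp_measurePreserving hmp
  have hbd : ∀ ζ, ‖(w ζ : ℂ) * f (ζ + r • shearGen d ζ)‖ ≤ C * ‖f (ζ + r • shearGen d ζ)‖ := by
    intro ζ
    rw [norm_mul, Complex.norm_real, Real.norm_eq_abs]
    exact mul_le_mul_of_nonneg_right (hC ζ) (norm_nonneg _)
  have h3 : MemLp (fun ζ => (w ζ : ℂ) * f (ζ + r • shearGen d ζ)) 2 volume :=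
    h2.of_le_mul ((Complex.continuous_ofReal.comp hw).aestronglyMeasurable.mul h2.1)
      (Filter.Eventually.of_forall hbd)
  refine ⟨h3.toLp _, h3.coeFn_toLp, ?_⟩
  have hC0 : 0 ≤ C := (abs_nonneg _).trans (hC 0)
  have h4 : eLpNorm (fun ζ => f (ζ + r • shearGen d ζ)) 2 volume = eLpNorm f 2 volume :=
    eLpNorm_comp_measurePreserving (Lp.aestronglyMeasurable f) hmp
  rw [Lp.norm_toLp, Lp.norm_def, ← h4, ← ENNReal.toReal_ofReal hC0, ← ENNReal.toReal_mul]
  refine ENNReal.toReal_mono (ENNReal.mul_ne_top ENNReal.ofReal_ne_top h2.2.ne) ?_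
  exact eLpNorm_le_mul_eLpNorm_of_ae_le_mul (Filter.Eventually.of_forall hbd) 2

lemma IsKolmogorovSolution.norm_le_norm_initial {g₀ : PhaseL2 d} {g : ℝ → PhaseL2 d}
    (hg : IsKolmogorovSolution g₀ g) {t : ℝ} (ht : 0 ≤ t) : ‖g t‖ ≤ ‖g₀‖ := by
  have hc := continuous_phaseFwd (d := d) t
  obtain ⟨k, hk, hkn⟩ := exists_Lp_eq_mul_comp_shear (𝓕 g₀ : PhaseL2 d)
    (w := fun ζ => Real.exp (-(4 * Real.pi ^ 2 * phaseFwd t ζ))) (by fun_prop) (C := 1)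
    (fun ζ => by
      rw [abs_of_pos (Real.exp_pos _), Real.exp_le_one_iff]
      have := phaseFwd_nonneg ht ζ
      have : 0 ≤ 4 * Real.pi ^ 2 * phaseFwd t ζ := by positivity
      linarith) t
  have : k = 𝓕 (g t) := Lp.ext (hk.trans (hg.fourier_ae_eq ht).symm)
  rw [this, one_mul, Lp.norm_fourier_eq, Lp.norm_fourier_eq] at hkn
  exact hkn

/-- The norm of a solution is nonincreasing in time. -/
lemma IsKolmogorovSolution.norm_le_norm {g₀ : PhaseL2 d} {g : ℝ → PhaseL2 d}
    (hg : IsKolmogorovSolution g₀ g) {s t : ℝ} (hs : 0 ≤ s) (hst : s ≤ t) : ‖g t‖ ≤ ‖g s‖ := by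
  have := (hg.shift hs).norm_le_norm_initial (sub_nonneg.2 hst)
  simpa using this

/-- Interpolation estimate between the norm on `ω` and the norm at an earlier time. -/
theorem IsObservabilityOpenSet.exists_interpolation {ω : Set (PhaseSpace d)}
    (hω : IsObservabilityOpenSet ω) :
    ∃ A : ℝ, 1 ≤ A ∧ ∃ K : ℝ, 0 < K ∧ ∀ (g₀ : PhaseL2 d) (g : ℝ → PhaseL2 d),
      IsKolmogorovSolution g₀ g → ∀ s t : ℝ, 0 ≤ s → s < t → t ≤ s + 1 → ∀ m : ℕ,
      ‖g t‖ ≤ A ^ (m + 1) * l2NormOn ω (g t) +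
        (1 / 2) ^ (m + 1) * (Real.exp (K / (t - s) ^ 3) * ‖g s‖) := by
  obtain ⟨A, hA, a, ha, h⟩ := hω.exists_norm_le_of_fourier_decay
  -- The constant K: a²/(π²τ³) is the maximum over x of a x - π²τ³x²/4, the exponent left by
  -- e^(a|ζ|) against the lower bound of the decay.
  refine ⟨A, hA, a ^ 2 / Real.pi ^ 2, by positivity, fun g₀ g hg s t hs hst hts m => ?_⟩
  set τ := t - s with hτ
  have hτ0 : 0 < τ := sub_pos.2 hst
  have hτ1 : τ ≤ 1 := by linarith
  have hc := continuous_phaseFwd (d := d) τ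
  have hF := (hg.shift hs).fourier_ae_eq hτ0.le
  rw [show s + τ = t by ring] at hF
  obtain ⟨k, hk, hkn⟩ := exists_Lp_eq_mul_comp_shear (𝓕 (g s) : PhaseL2 d)
    (w := fun ζ => Real.exp (a * ‖ζ‖) * Real.exp (-(4 * Real.pi ^ 2 * phaseFwd τ ζ)))
    (by fun_prop) (C := Real.exp (a ^ 2 / Real.pi ^ 2 / τ ^ 3))
    (fun ζ => by
      rw [← Real.exp_add, abs_of_pos (Real.exp_pos _), Real.exp_le_exp]
      have h1 := phaseFwd_lower hτ0.le hτ1 ζ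
      have h2 : 4 * Real.pi ^ 2 * (τ ^ 3 / 16 * ‖ζ‖ ^ 2) ≤ 4 * Real.pi ^ 2 * phaseFwd τ ζ := by
        gcongr
      have h3 : a * ‖ζ‖ - 4 * Real.pi ^ 2 * (τ ^ 3 / 16 * ‖ζ‖ ^ 2) =
          a ^ 2 / Real.pi ^ 2 / τ ^ 3 -
            Real.pi ^ 2 * τ ^ 3 / 4 * (‖ζ‖ - 2 * a / (Real.pi ^ 2 * τ ^ 3)) ^ 2 := by
        have := Real.pi_pos
        field_simp
        ring
      have h4 : 0 ≤ Real.pi ^ 2 * τ ^ 3 / 4 * (‖ζ‖ - 2 * a / (Real.pi ^ 2 * τ ^ 3)) ^ 2 := by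
        positivity
      linarith) τ
  have := h (g t) k ?_ m
  · refine this.trans ?_
    rw [Lp.norm_fourier_eq] at hkn
    exact add_le_add_right (mul_le_mul_of_nonneg_left hkn (by positivity)) _
  · filter_upwards [hF, hk] with ζ h1 h2
    rw [h1, h2, ← mul_assoc, ← Complex.ofReal_mul, ← mul_assoc, ← Real.exp_add, neg_add_cancel,
      Real.exp_zero, one_mul]

lemma abs_l2NormOn_sub_le (ω : Set (PhaseSpace d)) (f₁ f₂ : PhaseL2 d) :
    |l2NormOn ω f₁ - l2NormOn ω f₂| ≤ ‖f₁ - f₂‖ := by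
  have hm : ∀ f : PhaseL2 d, MemLp f 2 (volume.restrict ω) := fun f =>
    (Lp.memLp f).restrict ω
  have e : ∀ f₁ f₂ : PhaseL2 d, l2NormOn ω f₁ ≤ l2NormOn ω f₂ + ‖f₁ - f₂‖ := by
    intro f₁ f₂
    unfold l2NormOn
    rw [Lp.norm_def, ← ENNReal.toReal_add (hm f₂).2.ne (Lp.eLpNorm_ne_top _)]
    refine ENNReal.toReal_mono (ENNReal.add_ne_top.2 ⟨(hm f₂).2.ne, Lp.eLpNorm_ne_top _⟩) ?_
    calc eLpNorm f₁ 2 (volume.restrict ω)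
        = eLpNorm (fun z => f₂ z + (f₁ - f₂) z) 2 (volume.restrict ω) := by
          refine eLpNorm_congr_ae (ae_restrict_of_ae ?_)
          filter_upwards [Lp.coeFn_sub f₁ f₂] with z hz
          rw [hz, Pi.sub_apply, add_sub_cancel]
      _ ≤ eLpNorm f₂ 2 (volume.restrict ω) + eLpNorm (f₁ - f₂) 2 (volume.restrict ω) :=
          eLpNorm_add_le (hm f₂).1 (hm _).1 (by norm_num)
      _ ≤ _ := by
          gcongr
          exact Measure.restrict_le_self
  rw [abs_sub_le_iff]
  refine ⟨by linarith [e f₁ f₂], ?_⟩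
  rw [norm_sub_rev]
  linarith [e f₂ f₁]

lemma IsKolmogorovSolution.continuousOn_l2NormOn {g₀ : PhaseL2 d} {g : ℝ → PhaseL2 d}
    (hg : IsKolmogorovSolution g₀ g) (ω : Set (PhaseSpace d)) :
    ContinuousOn (fun t => l2NormOn ω (g t)) (Set.Ici 0) := by
  have : Continuous fun f : PhaseL2 d => l2NormOn ω f := by
    refine (LipschitzWith.of_dist_le_mul (K := 1) fun f₁ f₂ => ?_).continuous
    rw [Real.dist_eq, dist_eq_norm, NNReal.coe_one, one_mul]
    exact abs_l2NormOn_sub_le ω f₁ f₂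
  exact this.comp_continuousOn hg.continuousOn

end Smoothing

/-! ### From interpolation to observability in time. -/

section Telescoping

/-- The exponential rate produced by one step of the telescoping argument. -/
def stepRate (A K : ℝ) : ℝ := A * (2 * (8 * K + 1) + 2) + 4

/-- One step of the telescoping argument: an interpolation estimate at a set of times of
proportional measure, in weighted form. -/
lemma exp_mul_le_setIntegral_add {A K : ℝ} (hA : 1 ≤ A) (hK : 0 < K) {F N : ℝ → ℝ}
    (hF0 : ∀ t, 0 ≤ F t) (hN0 : ∀ t, 0 ≤ N t) (hN : ContinuousOn N (Set.Ici 0))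
    (hF : ∀ s t, 0 ≤ s → s ≤ t → F t ≤ F s)
    (hint : ∀ s t : ℝ, 0 ≤ s → s < t → t ≤ s + 1 → ∀ m : ℕ,
      F t ≤ A ^ (m + 1) * N t + (1 / 2) ^ (m + 1) * (Real.exp (K / (t - s) ^ 3) * F s))
    {s τ : ℝ} (hs : 0 ≤ s) (hτ : 0 < τ) (hτ1 : τ ≤ 1) {S : Set ℝ} (hSm : MeasurableSet S)
    (hS : S ⊆ Set.Ioc (s + τ / 2) (s + τ)) (hSv : τ / 4 ≤ volume.real S) :
    Real.exp (-(stepRate A K / τ ^ 3)) * F (s + τ) ≤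
      (∫ t in S, N t) + Real.exp (-((stepRate A K + 1) / τ ^ 3)) * F s := by
  set X : ℝ := 1 / τ ^ 3 with hX
  have hXτ : 1 / τ ≤ X := one_div_le_one_div_of_le (by positivity)
    (pow_le_of_le_one hτ.le hτ1 (by norm_num))
  have hX1 : 1 ≤ X := (one_le_one_div hτ hτ1).trans hXτ
  -- Since t - s ≥ τ/2, the smoothing cost is at most e^(8KX). As 1/2 ≤ e^(-1/2), this m makes
  -- 2^(-(m+1)) at most e^(-(8K+1)X), which leaves a gain e^(-X).
  set m : ℕ := ⌈2 * (8 * K + 1) * X⌉₊ with hm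
  have hm1 : 2 * (8 * K + 1) * X ≤ (m + 1 : ℕ) := by
    push_cast
    linarith [Nat.le_ceil (2 * (8 * K + 1) * X)]
  have hm2 : ((m + 1 : ℕ) : ℝ) ≤ 2 * (8 * K + 1) * X + 2 := by
    push_cast
    linarith [(Nat.ceil_lt_add_one (show 0 ≤ 2 * (8 * K + 1) * X by positivity)).le]
  have hAm : A ^ (m + 1) ≤ Real.exp (A * (2 * (8 * K + 1) + 2) * X) := by
    calc A ^ (m + 1) ≤ Real.exp A ^ (m + 1) := by
          gcongr
          linarith [Real.add_one_le_exp A]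
      _ = Real.exp ((m + 1 : ℕ) * A) := (Real.exp_nat_mul _ _).symm
      _ ≤ _ := by
          rw [Real.exp_le_exp]
          nlinarith [mul_le_mul_of_nonneg_left hm2 (by linarith : 0 ≤ A)]
  have h2m : (1 / 2 : ℝ) ^ (m + 1) ≤ Real.exp (-((8 * K + 1) * X)) := by
    have h2 : (1 / 2 : ℝ) ≤ Real.exp (-(1 / 2)) := by
      linarith [Real.add_one_le_exp (-(1 / 2) : ℝ)]
    calc (1 / 2 : ℝ) ^ (m + 1) ≤ Real.exp (-(1 / 2)) ^ (m + 1) := by gcongr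
      _ = Real.exp ((m + 1 : ℕ) * (-(1 / 2))) := (Real.exp_nat_mul _ _).symm
      _ ≤ _ := by
          rw [Real.exp_le_exp]
          linarith
  have hSfin : volume S ≠ ⊤ := ((measure_mono hS).trans_lt measure_Ioc_lt_top).ne
  have hpt : ∀ t ∈ S, F (s + τ) - Real.exp (-X) * F s ≤ A ^ (m + 1) * N t := by
    intro t ht
    have h1 := (hS ht).1
    have h2 := (hS ht).2
    have h3 := hint s t hs (by linarith) (by linarith) m
    have h4 := hF t (s + τ) (by linarith) h2
    have h5 : K / (t - s) ^ 3 ≤ 8 * K * X := by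
      calc K / (t - s) ^ 3 ≤ K / (τ / 2) ^ 3 := by
            gcongr
            linarith
        _ = 8 * K * X := by
            rw [hX]
            field_simp
            norm_num
    have h6 : (1 / 2 : ℝ) ^ (m + 1) * (Real.exp (K / (t - s) ^ 3) * F s) ≤
        Real.exp (-X) * F s := by
      rw [← mul_assoc]
      refine mul_le_mul_of_nonneg_right ?_ (hF0 s)
      calc _ ≤ Real.exp (-((8 * K + 1) * X)) * Real.exp (8 * K * X) := by gcongr
        _ = _ := by
          rw [← Real.exp_add]
          congr 1
          ring
    linarith
  have hNi : IntegrableOn N S := by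
    have : IntegrableOn N (Set.Icc s (s + τ)) :=
      (hN.mono fun x hx => hs.trans hx.1).integrableOn_compact isCompact_Icc
    exact this.mono_set fun x hx => ⟨by linarith [(hS hx).1], (hS hx).2⟩
  have hI0 : 0 ≤ ∫ t in S, N t := setIntegral_nonneg hSm fun t _ => hN0 t
  have hIm : volume.real S * (F (s + τ) - Real.exp (-X) * F s) ≤
      A ^ (m + 1) * ∫ t in S, N t := by
    have := setIntegral_mono_on (integrableOn_const hSfin) (hNi.const_mul (A ^ (m + 1))) hSm hpt
    rwa [setIntegral_const, integral_const_mul, smul_eq_mul] at this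
  -- The two terms of `stepRate` absorb A^(m+1), through A ≤ e^A and X ≥ 1, and the factor 4X, which
  -- dominates the 4/τ from the measure of S.
  have hrate : Real.exp (-(stepRate A K / τ ^ 3)) * (4 * X * A ^ (m + 1)) ≤ 1 := by
    have h4X : 4 * X ≤ Real.exp (4 * X) := by linarith [Real.add_one_le_exp (4 * X)]
    calc _ ≤ Real.exp (-(stepRate A K / τ ^ 3)) *
          (Real.exp (4 * X) * Real.exp (A * (2 * (8 * K + 1) + 2) * X)) := by gcongr
      _ = 1 := by
          rw [← Real.exp_add, ← Real.exp_add, Real.exp_eq_one_iff, stepRate, hX]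
          ring
  -- The lower bound on the measure of S can be used only when the left side is positive; otherwise
  -- the claim is trivial.
  have hmain : F (s + τ) - Real.exp (-X) * F s ≤ 4 * X * A ^ (m + 1) * ∫ t in S, N t := by
    rcases le_or_gt (F (s + τ) - Real.exp (-X) * F s) 0 with h | h
    · exact h.trans (by positivity)
    · have h1 := (mul_le_mul_of_nonneg_right hSv h.le).trans hIm
      calc F (s + τ) - Real.exp (-X) * F s
          = 4 * (1 / τ) * (τ / 4 * (F (s + τ) - Real.exp (-X) * F s)) := by field_simp
        _ ≤ 4 * X * (A ^ (m + 1) * ∫ t in S, N t) := by gcongr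
        _ = _ := by ring
  have h1 := mul_le_mul_of_nonneg_left hmain (Real.exp_pos (-(stepRate A K / τ ^ 3))).le
  rw [← mul_assoc, mul_sub, ← mul_assoc, ← Real.exp_add] at h1
  have h2 := mul_le_mul_of_nonneg_right hrate hI0
  have h3 : -(stepRate A K / τ ^ 3) + -X = -((stepRate A K + 1) / τ ^ 3) := by
    rw [hX]
    ring
  rw [h3] at h1
  linarith

/-- The telescoping argument: an interpolation estimate between any two times yields an
observability estimate from a set of times that fills most of every interval `(ℓ, ℓ + h')`. -/
theorem exists_telescoping_estimate {A K : ℝ} (hA : 1 ≤ A) (hK : 0 < K) :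
    ∃ C : ℝ, 0 < C ∧ ∃ η : ℝ, 0 < η ∧ ∀ F N : ℝ → ℝ,
      (∀ t, 0 ≤ F t) → (∀ t, 0 ≤ N t) → ContinuousOn N (Set.Ici 0) →
      (∀ s t, 0 ≤ s → s ≤ t → F t ≤ F s) →
      (∀ s t : ℝ, 0 ≤ s → s < t → t ≤ s + 1 → ∀ m : ℕ,
        F t ≤ A ^ (m + 1) * N t + (1 / 2) ^ (m + 1) * (Real.exp (K / (t - s) ^ 3) * F s)) →
      ∀ ℓ h : ℝ, 0 ≤ ℓ → 0 < h → h ≤ 1 → ∀ E : Set ℝ, MeasurableSet E →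
      (∀ h', 0 < h' → h' ≤ h → (1 - η) * h' ≤ volume.real (E ∩ Set.Ioc ℓ (ℓ + h'))) →
      F (ℓ + h) ≤ Real.exp (C / h ^ 3) * ∫ t in E ∩ Set.Ioc ℓ (ℓ + h), N t := by
  set μ := stepRate A K with hμ
  have hμ4 : 4 ≤ μ := by
    have : 0 ≤ A * (2 * (8 * K + 1) + 2) := by positivity
    rw [hμ, stepRate]
    linarith
  -- By Bernoulli, (1 - p)³ ≥ 1 - 3p = μ/(μ+1). Hence μ/τ_(k+1)³ ≤ (μ+1)/τ_k³, which is what lets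
  -- consecutive weighted steps telescope.
  set p : ℝ := 1 / (3 * (μ + 1)) with hp
  have hp0 : 0 < p := by positivity
  have hp1 : p < 1 := by
    rw [hp, div_lt_one (by positivity)]
    linarith
  refine ⟨μ / p ^ 3, by positivity, p / 4, by positivity, ?_⟩
  intro F N hF0 hN0 hN hF hint ℓ h hℓ hh hh1 E hE hdens
  set q : ℝ := 1 - p with hq
  have hq0 : 0 < q := by linarith
  have hq1 : q < 1 := by linarith
  have hq3 : μ / q ^ 3 ≤ μ + 1 := by
    rw [div_le_iff₀ (by positivity)]
    have hb : 1 + (3 : ℕ) * (-p) ≤ (1 + -p) ^ 3 := one_add_mul_le_pow (by linarith) 3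
    have hpm : p * (3 * (μ + 1)) = 1 := by
      rw [hp]
      field_simp
    have : (μ + 1) * (1 + (3 : ℕ) * (-p)) ≤ (μ + 1) * q ^ 3 := by
      rw [hq, sub_eq_add_neg]
      gcongr
    push_cast at this
    linarith
  set t : ℕ → ℝ := fun k => ℓ + q ^ k * h with ht
  set τ : ℕ → ℝ := fun k => p * (q ^ k * h) with hτ
  have hqk1 : ∀ k, q ^ k * h ≤ h := fun k =>
    mul_le_of_le_one_left hh.le (pow_le_one₀ hq0.le hq1.le)
  have hτ0 : ∀ k, 0 < τ k := fun k => by positivity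
  have hτ1 : ∀ k, τ k ≤ 1 := fun k =>
    mul_le_one₀ hp1.le (by positivity) ((hqk1 k).trans hh1)
  have htt : ∀ k, t (k + 1) + τ k = t k := by
    intro k
    simp only [ht, hτ, hq]
    ring
  have htℓ : ∀ k, ℓ ≤ t k := fun k => by
    simp only [ht]
    have : 0 ≤ q ^ k * h := by positivity
    linarith
  have hNi : ∀ S ⊆ Set.Icc ℓ (ℓ + h), IntegrableOn N S := fun S hS =>
    ((hN.mono fun x hx => hℓ.trans hx.1).integrableOn_compact isCompact_Icc).mono_set hS
  have htop : ∀ k, t k ≤ ℓ + h := fun k => add_le_add_right (hqk1 k) ℓ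
  have hstep : ∀ k, Real.exp (-(μ / τ k ^ 3)) * F (t k) ≤
      (∫ x in E ∩ Set.Ioc (t (k + 1)) (t k), N x) +
        Real.exp (-(μ / τ (k + 1) ^ 3)) * F (t (k + 1)) := by
    intro k
    -- The upper half of the step has length τ_k/2, and with η = p/4 the set E misses at most (p/4)
    -- q^k h = τ_k/4 of (ℓ, t_k], so at least τ_k/4 remains.
    set S := E ∩ Set.Ioc (t (k + 1) + τ k / 2) (t (k + 1) + τ k) with hS
    have hSm : MeasurableSet S := hE.inter measurableSet_Ioc
    have hSv : τ k / 4 ≤ volume.real S := by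
      have h1 := hdens (q ^ k * h) (by positivity) (hqk1 k)
      have hsub : E ∩ Set.Ioc ℓ (ℓ + q ^ k * h) ⊆ S ∪ Set.Ioc ℓ (t (k + 1) + τ k / 2) := by
        rintro x ⟨hxE, hx⟩
        rcases le_or_gt x (t (k + 1) + τ k / 2) with h | h
        · exact Or.inr ⟨hx.1, h⟩
        · refine Or.inl ⟨hxE, h, ?_⟩
          rw [htt k]
          exact hx.2
      have h2 : volume.real (E ∩ Set.Ioc ℓ (ℓ + q ^ k * h)) ≤
          volume.real S + volume.real (Set.Ioc ℓ (t (k + 1) + τ k / 2)) := by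
        refine (measureReal_mono hsub ?_).trans (measureReal_union_le _ _)
        refine (measure_union_lt_top ?_ measure_Ioc_lt_top).ne
        exact (measure_mono Set.inter_subset_right).trans_lt measure_Ioc_lt_top
      rw [Real.volume_real_Ioc_of_le (by linarith [htℓ (k + 1), hτ0 k])] at h2
      have h3 : t (k + 1) + τ k / 2 - ℓ = q ^ k * h - τ k / 2 := by
        have := htt k
        simp only [ht] at this ⊢
        linarith
      have h4 : p / 4 * (q ^ k * h) = τ k / 4 := by
        simp only [hτ]
        ring
      linarith
    have h1 := exp_mul_le_setIntegral_add hA hK hF0 hN0 hN hF hint (hℓ.trans (htℓ (k + 1))) (hτ0 k)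
      (hτ1 k) hSm Set.inter_subset_right hSv
    rw [htt k] at h1
    refine h1.trans (add_le_add ?_ (mul_le_mul_of_nonneg_right ?_ (hF0 _)))
    · refine setIntegral_mono_set (hNi _ ?_) (Filter.Eventually.of_forall hN0)
        (LE.le.eventuallyLE ?_)
      · exact fun x hx => ⟨(htℓ _).trans hx.2.1.le, hx.2.2.trans (htop k)⟩
      · rintro x ⟨hxE, hx⟩
        rw [htt k] at hx
        exact ⟨hxE, by linarith [hx.1, hτ0 k], hx.2⟩
    · rw [Real.exp_le_exp, neg_le_neg_iff]
      have : τ (k + 1) = q * τ k := by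
        simp only [hτ]
        ring
      rw [this, mul_pow, ← div_div]
      exact div_le_div_of_nonneg_right hq3 (pow_pos (hτ0 k) 3).le
  have hsum : ∀ n, Real.exp (-(μ / τ 0 ^ 3)) * F (t 0) ≤
      (∫ x in E ∩ Set.Ioc (t n) (t 0), N x) + Real.exp (-(μ / τ n ^ 3)) * F (t n) := by
    intro n
    induction n with
    | zero => simp
    | succ k ih =>
      have hle : t (k + 1) ≤ t k := by linarith [htt k, hτ0 k]
      have hle0 : t k ≤ t 0 := by
        have := htop k
        simp only [ht, pow_zero, one_mul] at this ⊢
        exact this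
      have hun : E ∩ Set.Ioc (t (k + 1)) (t 0) =
          (E ∩ Set.Ioc (t (k + 1)) (t k)) ∪ (E ∩ Set.Ioc (t k) (t 0)) := by
        rw [← Set.inter_union_distrib_left, Set.Ioc_union_Ioc_eq_Ioc hle hle0]
      rw [hun, setIntegral_union _ (hE.inter measurableSet_Ioc)]
      · linarith [hstep k]
      · exact hNi _ fun x hx => ⟨(htℓ _).trans hx.2.1.le, hx.2.2.trans (htop k)⟩
      · exact hNi _ fun x hx => ⟨(htℓ _).trans hx.2.1.le, hx.2.2.trans (htop 0)⟩
      · exact (Set.Ioc_disjoint_Ioc_of_le le_rfl).mono Set.inter_subset_right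
          Set.inter_subset_right
  have hlim : Filter.Tendsto (fun n => (∫ x in E ∩ Set.Ioc ℓ (ℓ + h), N x) + q ^ n * F ℓ)
      Filter.atTop (nhds ((∫ x in E ∩ Set.Ioc ℓ (ℓ + h), N x) + 0 * F ℓ)) :=
    ((tendsto_pow_atTop_nhds_zero_of_lt_one hq0.le hq1).mul_const _).const_add _
  have hbound : ∀ n, Real.exp (-(μ / τ 0 ^ 3)) * F (t 0) ≤
      (∫ x in E ∩ Set.Ioc ℓ (ℓ + h), N x) + q ^ n * F ℓ := by
    intro n
    refine (hsum n).trans (add_le_add ?_ ?_)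
    · refine setIntegral_mono_set (hNi _ ?_) (Filter.Eventually.of_forall hN0)
        (LE.le.eventuallyLE ?_)
      · exact fun x hx => ⟨hx.2.1.le, hx.2.2⟩
      · exact fun x hx => ⟨hx.1, (htℓ n).trans_lt hx.2.1, hx.2.2.trans (htop 0)⟩
    -- The last weight tends to zero: e^(-μ/τ_n³) ≤ τ_n³ ≤ τ_n ≤ q^n, while F(t_n) stays below F(ℓ).
    · refine mul_le_mul ?_ (hF _ _ hℓ (htℓ n)) (hF0 _) (by positivity)
      have hpos := hτ0 n
      have hc1 : τ n ≤ q ^ n := by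
        calc τ n ≤ 1 * (q ^ n * 1) := by
              simp only [hτ]
              gcongr
          _ = q ^ n := by ring
      have hc2 : τ n ^ 3 ≤ τ n := pow_le_of_le_one hpos.le (hτ1 n) (by norm_num)
      have hc3 : 1 / τ n ^ 3 ≤ μ / τ n ^ 3 := by
        gcongr
        linarith
      rw [Real.exp_neg]
      refine (inv_le_of_inv_le₀ (by positivity) ?_ : _ ≤ τ n ^ 3).trans (hc2.trans hc1)
      rw [← one_div]
      linarith [Real.add_one_le_exp (μ / τ n ^ 3)]
  have hfin := ge_of_tendsto' hlim hbound
  rw [zero_mul, add_zero] at hfin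
  have e1 : t 0 = ℓ + h := by simp [ht]
  have e2 : τ 0 = p * h := by simp [hτ]
  rw [e1, e2, mul_pow, ← div_div] at hfin
  calc F (ℓ + h) = Real.exp (μ / p ^ 3 / h ^ 3) *
        (Real.exp (-(μ / p ^ 3 / h ^ 3)) * F (ℓ + h)) := by
        rw [← mul_assoc, ← Real.exp_add, add_neg_cancel, Real.exp_zero, one_mul]
    _ ≤ _ := by gcongr

/-- One-sided Lebesgue density points. -/
lemma exists_mem_forall_le_volume_inter_Ioc {E : Set ℝ} (hEm : MeasurableSet E)
    (hE : volume E ≠ 0) {η : ℝ} (hη : 0 < η) :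
    ∃ ℓ ∈ E, ∃ ρ > 0, ∀ h', 0 < h' → h' ≤ ρ →
      (1 - η) * h' ≤ volume.real (E ∩ Set.Ioc ℓ (ℓ + h')) := by
  have : (ae (volume.restrict E)).NeBot := ae_neBot.2 (by simpa using hE)
  -- Lebesgue density along a Vitali family: the family need not be centred, so intervals with left
  -- endpoint ℓ are admissible.
  obtain ⟨ℓ, hℓ, hℓE⟩ := (((IsUnifLocDoublingMeasure.vitaliFamily (volume : Measure ℝ)
    1).ae_tendsto_measure_inter_div E).and (ae_restrict_mem hEm)).exists
  have hlim := hℓ.comp (Real.tendsto_Icc_vitaliFamily_right ℓ)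
  have hev := hlim.eventually (lt_mem_nhds (show ENNReal.ofReal (1 - η) < 1 by
    rw [ENNReal.ofReal_lt_one]
    linarith))
  obtain ⟨u, hu, hsub⟩ := mem_nhdsGT_iff_exists_Ioc_subset.1 hev
  refine ⟨ℓ, hℓE, u - ℓ, sub_pos.2 hu, fun h' h0 h1 => ?_⟩
  have h2 : ENNReal.ofReal (1 - η) <
      volume (E ∩ Set.Icc ℓ (ℓ + h')) / volume (Set.Icc ℓ (ℓ + h')) :=
    hsub (show ℓ + h' ∈ Set.Ioc ℓ u from ⟨by linarith, by linarith⟩)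
  have h3 : volume (E ∩ Set.Icc ℓ (ℓ + h')) = volume (E ∩ Set.Ioc ℓ (ℓ + h')) :=
    measure_congr ((ae_eq_refl E).inter Ioc_ae_eq_Icc.symm)
  have hfin : volume (E ∩ Set.Ioc ℓ (ℓ + h')) ≠ ⊤ :=
    ((measure_mono Set.inter_subset_right).trans_lt measure_Ioc_lt_top).ne
  rw [h3, Real.volume_Icc, add_sub_cancel_left, ENNReal.lt_div_iff_mul_lt
    (Or.inl (by simpa using h0)) (Or.inl ENNReal.ofReal_ne_top),
    ← ENNReal.ofReal_mul' h0.le] at h2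
  exact (ENNReal.ofReal_le_iff_le_toReal hfin).1 h2.le

end Telescoping

end

/-! ### Conclusion. -/

theorem corollary1 (d : ℕ) (hd : 0 < d) (ω : Set (PhaseSpace d))
    (hω : IsObservabilityOpenSet ω) :
    (∀ T : ℝ, 0 < T → ∀ E : Set ℝ, E ⊆ Set.Ioo 0 T →
      NullMeasurableSet E (volume : Measure ℝ) → 0 < (volume : Measure ℝ) E →
      ∃ Cobs : ℝ, 0 < Cobs ∧ ∀ (g₀ : PhaseL2 d) (g : ℝ → PhaseL2 d),
        IsKolmogorovSolution g₀ g → ‖g T‖ ≤ Cobs * ∫ t in E, l2NormOn ω (g t)) ∧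
    (∃ C : ℝ, 0 < C ∧ ∀ T : ℝ, 0 < T → ∀ (g₀ : PhaseL2 d) (g : ℝ → PhaseL2 d),
      IsKolmogorovSolution g₀ g →
        ‖g T‖ ≤ Real.exp (C * (1 + 1 / T ^ 3)) * ∫ t in Set.Ioo 0 T, l2NormOn ω (g t)) := by
  obtain ⟨A, hA, K, hK, hinterp⟩ := hω.exists_interpolation
  obtain ⟨C, hC, η, hη, htel⟩ := exists_telescoping_estimate hA hK
  have hN0 : ∀ f : PhaseL2 d, 0 ≤ l2NormOn ω f := fun f => ENNReal.toReal_nonneg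
  have hobs : ∀ (g₀ : PhaseL2 d) (g : ℝ → PhaseL2 d), IsKolmogorovSolution g₀ g →
      ∀ ℓ h : ℝ, 0 ≤ ℓ → 0 < h → h ≤ 1 → ∀ E : Set ℝ, MeasurableSet E →
      (∀ h', 0 < h' → h' ≤ h → (1 - η) * h' ≤ volume.real (E ∩ Set.Ioc ℓ (ℓ + h'))) →
      ‖g (ℓ + h)‖ ≤ Real.exp (C / h ^ 3) * ∫ t in E ∩ Set.Ioc ℓ (ℓ + h), l2NormOn ω (g t) :=
    fun g₀ g hg => htel (fun t => ‖g t‖) (fun t => l2NormOn ω (g t)) (fun _ => norm_nonneg _)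
      (fun _ => hN0 _) (hg.continuousOn_l2NormOn ω) (fun _ _ => hg.norm_le_norm) (hinterp g₀ g hg)
  have hmono : ∀ (g₀ : PhaseL2 d) (g : ℝ → PhaseL2 d), IsKolmogorovSolution g₀ g → ∀ T : ℝ,
      ∀ S E : Set ℝ, E ⊆ Set.Ioo 0 T → S ⊆ E →
      ∫ t in S, l2NormOn ω (g t) ≤ ∫ t in E, l2NormOn ω (g t) := by
    intro g₀ g hg T S E hE hS
    refine setIntegral_mono_set ?_ (Filter.Eventually.of_forall fun _ => hN0 _)
      (LE.le.eventuallyLE hS)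
    have : IntegrableOn (fun t => l2NormOn ω (g t)) (Set.Icc 0 T) :=
      ((hg.continuousOn_l2NormOn ω).mono fun x hx => hx.1).integrableOn_compact isCompact_Icc
    exact this.mono_set (hE.trans Set.Ioo_subset_Icc_self)
  refine ⟨fun T hT E hE hEm hEpos => ?_, C, hC, fun T hT g₀ g hg => ?_⟩
  · obtain ⟨E', hE'E, hE'm, hE'ae⟩ := hEm.exists_measurable_subset_ae_eq
    obtain ⟨ℓ, hℓ, ρ, hρ, hdens⟩ := exists_mem_forall_le_volume_inter_Ioc hE'm
      (by rw [measure_congr hE'ae]; exact hEpos.ne') hη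
    have hℓT := hE (hE'E hℓ)
    -- Chosen from E and T alone, so the constant does not depend on the solution. The estimate at
    -- time ℓ + h ≤ T reaches T by monotonicity of the norm.
    set h := min ρ (min 1 (T - ℓ)) with hh
    have hpos : 0 < h := lt_min hρ (lt_min one_pos (sub_pos.2 hℓT.2))
    have hle1 : h ≤ 1 := (min_le_right _ _).trans (min_le_left _ _)
    have hleT : h ≤ T - ℓ := (min_le_right _ _).trans (min_le_right _ _)
    refine ⟨Real.exp (C / h ^ 3), Real.exp_pos _, fun g₀ g hg => ?_⟩
    calc ‖g T‖ ≤ ‖g (ℓ + h)‖ := hg.norm_le_norm (by linarith [hℓT.1]) (by linarith)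
      _ ≤ _ := hobs g₀ g hg ℓ h hℓT.1.le hpos hle1 E' hE'm fun h' h0 h1 =>
        hdens h' h0 (h1.trans (min_le_left _ _))
      _ ≤ _ := mul_le_mul_of_nonneg_left
        (hmono g₀ g hg T _ E hE (Set.inter_subset_left.trans hE'E)) (Real.exp_pos _).le
  -- On the full interval ℓ = 0 is admissible with density one at every scale up to T. Capping h at
  -- 1 produces the constant term in C(1 + 1/T³).
  · set h := min T 1 with hh
    have hpos : 0 < h := lt_min hT one_pos
    have hle1 : h ≤ 1 := min_le_right _ _
    have hleT : h ≤ T := min_le_left _ _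
    have hCh : C / h ^ 3 ≤ C * (1 + 1 / T ^ 3) := by
      rw [div_eq_mul_one_div]
      have hT3 : 0 ≤ 1 / T ^ 3 := by positivity
      gcongr
      rcases min_cases T 1 with ⟨h1, -⟩ | ⟨h1, -⟩
      · rw [hh, h1]
        linarith
      · rw [hh, h1]
        norm_num
        positivity
    have key := hobs g₀ g hg 0 h le_rfl hpos hle1 (Set.Ioo 0 T) measurableSet_Ioo
      fun h' h0 h1 => by
        have e : volume.real (Set.Ioo 0 T ∩ Set.Ioc 0 (0 + h')) = h' := by
          have : Set.Ioo 0 h' ⊆ Set.Ioo 0 T ∩ Set.Ioc 0 (0 + h') := fun x hx =>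
            ⟨⟨hx.1, hx.2.trans_le (h1.trans hleT)⟩, hx.1, by simpa using hx.2.le⟩
          refine le_antisymm ?_ ?_
          · refine (measureReal_mono Set.inter_subset_right measure_Ioc_lt_top.ne).trans ?_
            rw [Real.volume_real_Ioc_of_le (by linarith)]
            simp
          · refine le_trans ?_ (measureReal_mono this ?_)
            · rw [Real.volume_real_Ioo_of_le h0.le, sub_zero]
            · exact ((measure_mono Set.inter_subset_right).trans_lt measure_Ioc_lt_top).ne
        rw [e]
        nlinarith
    calc ‖g T‖ ≤ ‖g (0 + h)‖ := hg.norm_le_norm (by linarith) (by linarith)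
      _ ≤ _ := key
      _ ≤ _ := mul_le_mul (Real.exp_le_exp.2 hCh)
        (hmono g₀ g hg T _ _ subset_rfl Set.inter_subset_left)
        (integral_nonneg fun _ => hN0 _) (Real.exp_pos _).le
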